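/- Let $n\ge 1$. For $1\le k\le n$, let $\nu^{(k)}$ be the law on $U(n)$ of the random reflection $r^{(k)}$ defined as follows: take $x=(0,\dots,0,x_k,\dots,x_n)^{\top}$ with $(x_k,\dots,x_n)$ uniformly distributed on the unit sphere of $\mathbb{C}^{n-k+1}$, and let $r^{(k)}$ be the unitary matrix with $$r^{(k)}e_k=x,\qquad r^{(k)}e_j=e_j-\frac{\overline{x_j}}{1-\overline{x_k}}\,(x-e_k)\quad(j\ne k),$$ (so that $r^{(k)}e_j=e_j$ for $j<k$ and $r^{(k)}-\mathrm{Id}$ has rank at most $1$; if $x=e_k$, an event of probability $0$, put $r^{(k)}=\mathrm{Id}$). **Lemma 3.1.** Let $u$ be distributed according to the Haar probability measure on $U(n)$, let $\theta$ be uniformly distributed on $(-\pi,\pi)$, and let $r^{(k)}\sim\nu^{(k)}$ for $1\le k\le n$, all these random variables being independent. Then the spectra of $$u\qquad\text{and}\qquad e^{i\theta}\,r^{(1)}r^{(2)}\cdots r^{(n-1)}$$ are equal in law, where the spectrum of a matrix is the random multiset of its $n$ eigenvalues counted with multiplicity. (For $n=1$ the product of reflections is the identity.) -/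

import Mathlib

open MeasureTheory ProbabilityTheory

noncomputable section

namespace ConditionalHaar

/-- The unitary group `U(n)`. -/
abbrev U (n : ℕ) : Type := Matrix.unitaryGroup (Fin n) ℂ

/-- `U(n)` carries its Borel sigma-algebra. -/
instance instMeasurableSpaceU (n : ℕ) : MeasurableSpace (U n) := borel (U n)

instance instBorelSpaceU (n : ℕ) : BorelSpace (U n) := ⟨rfl⟩

/-- The unit sphere of the complex Euclidean space with coordinates `x_j`, `k ≤ j`
(coordinates of `ℂⁿ` are numbered from `0` to `n - 1`). -/
abbrev TailSphere {n : ℕ} (k : Fin n) : Type :=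
  Metric.sphere (0 : EuclideanSpace ℂ {j : Fin n // k ≤ j}) 1

/-- The uniform probability measure on that sphere: normalized surface measure. -/
def uniformTailSphere {n : ℕ} (k : Fin n) : Measure (TailSphere k) :=
  ((volume : Measure (EuclideanSpace ℂ {j : Fin n // k ≤ j})).toSphere Set.univ)⁻¹ •
    (volume : Measure (EuclideanSpace ℂ {j : Fin n // k ≤ j})).toSphere

/-- The vector `(0, …, 0, x_k, …, x_{n-1})` of `ℂⁿ`. -/
def extendZero {n : ℕ} (k : Fin n) (x : TailSphere k) : Fin n → ℂ :=
  fun j => if h : k ≤ j then x.1 ⟨j, h⟩ else 0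

/-- The matrix with `k`-th column `w` and `j`-th column
`e_j - (conj w_j / (1 - conj w_k)) (w - e_k)` for `j ≠ k`.
If `w` vanishes before the index `k`, this is the block matrix `Id ⊕ m`, where `m` has first
column `m_1 = (w_k, …, w_{n-1})` and its other columns are
`e_j - (conj m_{1j} / (1 - conj m_{11})) (m_1 - e_1)`.
(If `w = e_k`, it is the identity matrix.) -/
def reflectionMatrix {n : ℕ} (k : Fin n) (w : Fin n → ℂ) : Matrix (Fin n) (Fin n) ℂ :=
  Matrix.of fun i j =>
    if j = k then w i
    else (if i = j then 1 else 0) -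
      (w i - if i = k then 1 else 0) * (star (w j) / (1 - star (w k)))

theorem extendZero_norm {n : ℕ} (k : Fin n) (x : TailSphere k) :
    ∑ j, star (extendZero k x j) * extendZero k x j = 1 := by
  have hx : ‖x.1‖ = 1 := by simp
  have h1 : ∑ j, ‖x.1 j‖ ^ 2 = 1 := by
    rw [← EuclideanSpace.norm_sq_eq, hx, one_pow]
  have h2 : ∀ z : ℂ, star z * z = ((‖z‖ ^ 2 : ℝ) : ℂ) := by
    intro z
    rw [Complex.star_def, Complex.conj_mul']
    push_cast
    rfl
  rw [← Finset.sum_subset (Finset.subset_univ (Finset.univ.filter fun j => k ≤ j))]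
  · rw [Finset.sum_subtype (p := fun j => k ≤ j) _ (by simp)]
    have : ∀ j : {j : Fin n // k ≤ j}, star (extendZero k x j.1) * extendZero k x j.1
        = ((‖x.1 j‖ ^ 2 : ℝ) : ℂ) := by
      intro j
      rw [h2]
      simp [extendZero, j.2]
    rw [Finset.sum_congr rfl fun j _ => this j, ← Complex.ofReal_sum, h1, Complex.ofReal_one]
  · intro j _ hj
    have : ¬ k ≤ j := by simpa using hj
    simp [extendZero, this]

theorem reflectionMatrix_mem {n : ℕ} (k : Fin n) (w : Fin n → ℂ)
    (hw : ∑ j, star (w j) * w j = 1) :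
    reflectionMatrix k w ∈ Matrix.unitaryGroup (Fin n) ℂ := by
  set e : Fin n → ℂ := Pi.single k 1 with he
  have hek : ∀ i, e i = if i = k then 1 else 0 := by
    intro i
    simp [he, Pi.single_apply]
  by_cases hk : w k = 1
  · -- then `w = e_k`
    have hz : ∀ j, j ≠ k → w j = 0 := by
      intro j hj
      have h2 : ∀ z : ℂ, star z * z = ((‖z‖ ^ 2 : ℝ) : ℂ) := by
        intro z
        rw [Complex.star_def, Complex.conj_mul']
        push_cast
        rfl
      simp only [h2] at hw
      rw [← Complex.ofReal_sum, Complex.ofReal_eq_one] at hw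
      rw [← Finset.add_sum_erase _ _ (Finset.mem_univ k), hk] at hw
      have h0 : ∑ i ∈ Finset.univ.erase k, ‖w i‖ ^ 2 = 0 := by simpa using hw
      rw [Finset.sum_eq_zero_iff_of_nonneg (fun i _ => by positivity)] at h0
      simpa using h0 j (by simp [hj])
    have : reflectionMatrix k w = 1 := by
      ext i j
      by_cases hj : j = k
      · subst hj
        by_cases hi : i = j
        · subst hi; simp [reflectionMatrix, hk]
        · simp [reflectionMatrix, hi, hz i hi]
      · simp [reflectionMatrix, hj, hz j hj, Matrix.one_apply]
    rw [this]
    exact one_mem _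
  · have hk0 : 1 - w k ≠ 0 := sub_ne_zero.2 (Ne.symm hk)
    have hk1 : 1 - star (w k) ≠ 0 := by
      intro h
      apply hk0
      have := congrArg star h
      simpa using this
    set c : ℂ := -(1 - star (w k))⁻¹ with hc
    have hcs : star c = -(1 - w k)⁻¹ := by simp [hc]
    have hR : reflectionMatrix k w = 1 + c • Matrix.vecMulVec (w - e) (star (w - e)) := by
      ext i j
      by_cases hj : j = k
      · subst hj
        simp [reflectionMatrix, Matrix.vecMulVec_apply, hek, Matrix.one_apply, hc]
        simp only [Complex.star_def] at hk1
        field_simp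
        ring
      · simp [reflectionMatrix, Matrix.vecMulVec_apply, hek, Matrix.one_apply, hc, hj]
        ring
    have hd : star (w - e) ⬝ᵥ (w - e) = (1 - w k) + (1 - star (w k)) := by
      have h3 : star w ⬝ᵥ w = 1 := by simpa [dotProduct] using hw
      have h4 : star w ⬝ᵥ e = star (w k) := by simp [he]
      have h5 : star e = e := by
        ext i
        simp only [Pi.star_apply, hek]
        split_ifs <;> simp
      rw [star_sub, sub_dotProduct, dotProduct_sub, dotProduct_sub, h3, h4, h5]
      simp [he]
      ring
    rw [Matrix.mem_unitaryGroup_iff', hR, Matrix.star_eq_conjTranspose, Matrix.conjTranspose_add,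
      Matrix.conjTranspose_smul, Matrix.conjTranspose_vecMulVec, star_star,
      Matrix.conjTranspose_one, add_mul, mul_add, mul_add, one_mul, mul_one, one_mul,
      smul_mul_smul_comm, Matrix.vecMulVec_mul_vecMulVec, hd, Matrix.vecMulVec_smul, smul_smul,
      add_assoc, ← add_smul, ← add_smul]
    have : c + (star c + star c * c * ((1 - w k) + (1 - star (w k)))) = 0 := by
      rw [hcs, hc]
      field_simp
      ring
    rw [this, zero_smul, add_zero]

/-- The reflection in `U(n)` that fixes `e_j` for `j < k` and sends `e_k` to
`(0, …, 0, x_k, …, x_{n-1})`. -/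
def reflection {n : ℕ} (k : Fin n) (x : TailSphere k) : U n :=
  ⟨reflectionMatrix k (extendZero k x), reflectionMatrix_mem k _ (extendZero_norm k x)⟩

theorem measurable_reflection {n : ℕ} (k : Fin n) : Measurable (reflection k) := by
  have hx : ∀ j, Measurable fun x : TailSphere k => extendZero k x j := by
    intro j
    unfold extendZero
    by_cases h : k ≤ j
    · simp only [h, dif_pos]
      exact Continuous.measurable (by fun_prop)
    · simp only [h, dif_neg, not_false_eq_true]
      exact measurable_const
  borelize (Matrix (Fin n) (Fin n) ℂ)
  have hM : (inferInstance : MeasurableSpace (Matrix (Fin n) (Fin n) ℂ))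
      = (MeasurableSpace.pi : MeasurableSpace (Fin n → Fin n → ℂ)) :=
    (BorelSpace.measurable_eq (α := Fin n → Fin n → ℂ)).symm
  have hU : instMeasurableSpaceU n = MeasurableSpace.comap Subtype.val
      (borel (Matrix (Fin n) (Fin n) ℂ)) := borel_comap
  rw [hU]
  rw [measurable_comap_iff]
  change Measurable[_, borel (Fin n → Fin n → ℂ)] _
  rw [← BorelSpace.measurable_eq (α := Fin n → Fin n → ℂ)]
  refine measurable_pi_lambda _ fun i => measurable_pi_lambda _ fun j => ?_
  simp only [Function.comp, reflection, reflectionMatrix, Matrix.of_apply]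
  have hs : ∀ j, Measurable fun x : TailSphere k => star (extendZero k x j) := fun j =>
    (continuous_star.measurable).comp (hx j)
  split_ifs <;>
  first
    | exact hx i
    | exact measurable_const.sub
        (((hx i).sub measurable_const).mul ((hs j).div (measurable_const.sub (hs k))))

/-- The law of the reflection when `x` is uniform on the sphere. -/
def nu {n : ℕ} (k : Fin n) : Measure (U n) := (uniformTailSphere k).map (reflection k)

/-- The spectrum of a complex matrix: the multiset of its eigenvalues, counted with
(algebraic) multiplicity. -/
def spec {n : ℕ} (A : Matrix (Fin n) (Fin n) ℂ) : Multiset ℂ := A.charpoly.roots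

/-- The sigma-algebra on finite multisets (the disjoint union of the symmetric powers of `ℂ`):
a set of multisets is measurable when, for every `m`, the set of all `x ∈ ℂᵐ` whose
unordered tuple `{x_1, …, x_m}` belongs to it is a Borel set. -/
instance instMeasurableSpaceMultiset : MeasurableSpace (Multiset ℂ) :=
  ⨅ m : ℕ, MeasurableSpace.map (fun x : Fin m → ℂ => (Multiset.ofList (List.ofFn x))) inferInstance

end ConditionalHaar

end

noncomputable section

namespace ConditionalHaar

open Filter Topology

/-! More than equality of spectra holds: the matrix `e^{iθ} r⁽¹⁾⋯r⁽ⁿ⁻¹⁾` is itself Haar distributed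
(`hasLaw_scalarU_mul_prod_reflections`), and the spectrum is a measurable function of the matrix
(`measurable_spec`).

By the subgroup algorithm, `g = r⁽¹⁾⋯r⁽ⁿ⁾` is Haar (`mconvList_nu`). The last reflection is
`diag(1,…,1,z)`, so `g = W D(z)` with `W = r⁽¹⁾⋯r⁽ⁿ⁻¹⁾` and `D(z) = coordU k z`, `k` being the last
index. Since `1 - W` has rank at most `n - 1`, `W` fixes a nonzero vector. Writing `T` for `transfer
k`, a fixed vector of `W = g D(z)⁻¹` forces `T(g) = z` when the defining inverse exists
(`transfer_eq_of_fixed`). So `W = g D(T(g))⁻¹ = fixedRep k g` almost surely, and `W` is a function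
of a Haar matrix.

For an independent uniform scalar `ζ`, left invariance allows `g` to be replaced by `ζ⁻¹g` in `ζ ·
fixedRep k g`, and the scalars cancel: what remains is `g D(T(ζ⁻¹g))⁻¹`. With `g` held fixed, `ζ ↦
T(ζg)` is an inner function vanishing at `0`, hence preserves the uniform measure of the circle
(`map_circleTransfer`). The law is therefore that of `g D(z)` with `z` uniform and independent of
`g`, which is Haar by right invariance (`lintegral_scalarU_mul_fixedRep`). -/

/-! ### Measurability of the spectrum. -/

theorem continuous_charpoly_coeff (n i : ℕ) :
    Continuous fun A : Matrix (Fin n) (Fin n) ℂ => A.charpoly.coeff i := by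
  have h : ∀ A : Matrix (Fin n) (Fin n) ℂ, A.charpoly.coeff i =
      MvPolynomial.eval (fun p : Fin n × Fin n => A p.1 p.2)
        ((Matrix.charpoly.univ ℂ (Fin n)).coeff i) := by
    intro A
    exact (Matrix.charpoly.univ_coeff_eval₂Hom (Fin n) (RingHom.id ℂ)
      (fun p => A p.1 p.2) i).symm
  simp_rw [h]
  exact (MvPolynomial.continuous_eval _).comp (by fun_prop)

/-- The coefficients of the characteristic polynomial, without the leading one. -/
def charpolyCoeffs {n : ℕ} (A : Matrix (Fin n) (Fin n) ℂ) : Fin n → ℂ :=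
  fun i => A.charpoly.coeff i

/-- The monic polynomial of degree `n` with given lower coefficients. -/
def monicOfCoeffs {n : ℕ} (c : Fin n → ℂ) : Polynomial ℂ :=
  Polynomial.X ^ n + ∑ i : Fin n, Polynomial.C (c i) * Polynomial.X ^ (i : ℕ)

theorem monicOfCoeffs_eq {n : ℕ} {p : Polynomial ℂ} (hp : p.Monic) (hn : p.natDegree = n) :
    monicOfCoeffs (fun i : Fin n => p.coeff i) = p := by
  conv_rhs => rw [hp.as_sum, hn]
  rw [monicOfCoeffs, Fin.sum_univ_eq_sum_range (fun i => Polynomial.C (p.coeff i) *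
    Polynomial.X ^ i)]

theorem monicOfCoeffs_degree_lt {n : ℕ} (c : Fin n → ℂ) :
    (∑ i : Fin n, Polynomial.C (c i) * Polynomial.X ^ (i : ℕ)).degree < (n : WithBot ℕ) :=
  Polynomial.degree_sum_fin_lt c

theorem monicOfCoeffs_monic {n : ℕ} (c : Fin n → ℂ) : (monicOfCoeffs c).Monic :=
  Polynomial.monic_X_pow_add (monicOfCoeffs_degree_lt c)

theorem monicOfCoeffs_natDegree {n : ℕ} (c : Fin n → ℂ) : (monicOfCoeffs c).natDegree = n := by
  apply Polynomial.natDegree_eq_of_degree_eq_some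
  rw [monicOfCoeffs, Polynomial.degree_add_eq_left_of_degree_lt, Polynomial.degree_X_pow]
  rw [Polynomial.degree_X_pow]
  exact monicOfCoeffs_degree_lt c

theorem monicOfCoeffs_coeff {n : ℕ} (c : Fin n → ℂ) (i : Fin n) :
    (monicOfCoeffs c).coeff i = c i := by
  simp [monicOfCoeffs, Polynomial.coeff_X_pow, i.2.ne, Fin.val_inj]

theorem charpoly_diagonal_eq_multiset_prod {n : ℕ} (x : Fin n → ℂ) :
    (Matrix.diagonal x).charpoly =
      ((Multiset.ofList (List.ofFn x)).map fun a => Polynomial.X - Polynomial.C a).prod := by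
  rw [Matrix.charpoly_diagonal, Multiset.map_coe, Multiset.prod_coe, List.map_ofFn, List.prod_ofFn]
  rfl

theorem charpolyCoeffs_diagonal_surjective (n : ℕ) :
    Function.Surjective fun x : Fin n → ℂ => charpolyCoeffs (Matrix.diagonal x) := by
  intro c
  have hs := IsAlgClosed.splits (monicOfCoeffs c)
  have hcard : (monicOfCoeffs c).roots.toList.length = n := by
    rw [Multiset.length_toList, ← hs.natDegree_eq_card_roots, monicOfCoeffs_natDegree]
  refine ⟨fun i => (monicOfCoeffs c).roots.toList.get (i.cast hcard.symm), ?_⟩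
  have hl : List.ofFn (fun i : Fin n => (monicOfCoeffs c).roots.toList.get (i.cast hcard.symm)) =
      (monicOfCoeffs c).roots.toList := by
    apply List.ext_get
    · simp [hcard]
    · intro i h1 h2
      simp
  have hp : (Matrix.diagonal fun i : Fin n =>
      (monicOfCoeffs c).roots.toList.get (i.cast hcard.symm)).charpoly = monicOfCoeffs c := by
    rw [charpoly_diagonal_eq_multiset_prod, hl, Multiset.coe_toList,
      ← hs.eq_prod_roots_of_monic (monicOfCoeffs_monic c)]
  ext i
  simp only [charpolyCoeffs, hp, monicOfCoeffs_coeff]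

theorem continuous_charpolyCoeffs (n : ℕ) :
    Continuous (charpolyCoeffs : Matrix (Fin n) (Fin n) ℂ → Fin n → ℂ) :=
  continuous_pi fun i => continuous_charpoly_coeff n i

theorem measurable_ofFn_multiset (n : ℕ) :
    Measurable fun x : Fin n → ℂ => (Multiset.ofList (List.ofFn x)) := by
  intro s hs
  have := (MeasurableSpace.measurableSet_iInf.1 hs) n
  exact this

/-- No measurable choice of roots is needed. Coefficients are a measurable surjective image of root
tuples, and a measurable surjection between standard Borel spaces detects measurability of whatever
is composed with it. On tuples the map is `x ↦ {x_1, …, x_n}`, measurable by the choice of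
sigma-algebra. -/
theorem measurable_roots_monicOfCoeffs (n : ℕ) :
    Measurable fun c : Fin n → ℂ => (monicOfCoeffs c).roots := by
  have hm : Measurable fun x : Fin n → ℂ => charpolyCoeffs (Matrix.diagonal x) :=
    ((continuous_charpolyCoeffs n).comp (by fun_prop)).measurable
  rw [← hm.measurable_comp_iff_of_surjective (charpolyCoeffs_diagonal_surjective n)]
  convert measurable_ofFn_multiset n using 1
  ext1 x
  have := monicOfCoeffs_eq (Matrix.charpoly_monic (Matrix.diagonal x))
    (by rw [Matrix.charpoly_natDegree_eq_dim, Fintype.card_fin])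
  simp only [Function.comp]
  unfold charpolyCoeffs
  rw [this, charpoly_diagonal_eq_multiset_prod, Polynomial.roots_multiset_prod_X_sub_C]

theorem measurable_spec (n : ℕ) :
    Measurable fun u : U n => spec (u : Matrix (Fin n) (Fin n) ℂ) := by
  have h : ∀ u : U n, spec (u : Matrix (Fin n) (Fin n) ℂ) =
      (monicOfCoeffs (charpolyCoeffs (u : Matrix (Fin n) (Fin n) ℂ))).roots := by
    intro u
    unfold spec charpolyCoeffs
    rw [monicOfCoeffs_eq (Matrix.charpoly_monic _)
      (by rw [Matrix.charpoly_natDegree_eq_dim, Fintype.card_fin])]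
  simp_rw [h]
  exact (measurable_roots_monicOfCoeffs n).comp
    ((continuous_charpolyCoeffs n).comp continuous_subtype_val).measurable

/-! ### The transfer function of a unitary matrix. -/

theorem sum_norm_sq_mulVec {n : ℕ} {g : Matrix (Fin n) (Fin n) ℂ}
    (hg : g ∈ Matrix.unitaryGroup (Fin n) ℂ) (v : Fin n → ℂ) :
    ∑ i, ‖(g.mulVec v) i‖ ^ 2 = ∑ i, ‖v i‖ ^ 2 := by
  have h : ∀ w : Fin n → ℂ, ((∑ i, ‖w i‖ ^ 2 : ℝ) : ℂ) = star w ⬝ᵥ w := by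
    intro w
    simp only [dotProduct, Pi.star_apply, Complex.star_def, Complex.conj_mul']
    push_cast
    rfl
  have : ((∑ i, ‖(g.mulVec v) i‖ ^ 2 : ℝ) : ℂ) = ((∑ i, ‖v i‖ ^ 2 : ℝ) : ℂ) := by
    rw [h, h, Matrix.star_mulVec, Matrix.dotProduct_mulVec, Matrix.vecMul_vecMul,
      ← Matrix.star_eq_conjTranspose, Matrix.mem_unitaryGroup_iff'.1 hg, Matrix.vecMul_one]
  exact_mod_cast this

/-- The matrix `1 - P A`, where `P` kills the `k`-th coordinate. -/
def compressionDefect {n : ℕ} (k : Fin n) (A : Matrix (Fin n) (Fin n) ℂ) :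
    Matrix (Fin n) (Fin n) ℂ :=
  1 - A.updateRow k 0

/-- The transfer function `⟨e_k, A (1 - P A)⁻¹ e_k⟩`, where `P` kills the `k`-th coordinate. -/
def transfer {n : ℕ} (k : Fin n) (A : Matrix (Fin n) (Fin n) ℂ) : ℂ :=
  (A * (compressionDefect k A)⁻¹) k k

theorem compressionDefect_mulVec {n : ℕ} (k : Fin n) (A : Matrix (Fin n) (Fin n) ℂ)
    (v : Fin n → ℂ) (i : Fin n) :
    (compressionDefect k A).mulVec v i = if i = k then v k else v i - A.mulVec v i := by
  rw [compressionDefect, Matrix.sub_mulVec, Matrix.one_mulVec, Pi.sub_apply]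
  split_ifs with h
  · subst h
    simp [Matrix.mulVec]
  · simp [Matrix.mulVec, h]

/-- The vector `(1 - P A)⁻¹ e_k`. -/
def resolventVec {n : ℕ} (k : Fin n) (A : Matrix (Fin n) (Fin n) ℂ) : Fin n → ℂ :=
  (compressionDefect k A)⁻¹.mulVec (Pi.single k 1)

theorem compressionDefect_mulVec_resolventVec {n : ℕ} {k : Fin n} {A : Matrix (Fin n) (Fin n) ℂ}
    (h : (compressionDefect k A).det ≠ 0) :
    (compressionDefect k A).mulVec (resolventVec k A) = Pi.single k 1 := by
  rw [resolventVec, Matrix.mulVec_mulVec, Matrix.mul_nonsing_inv _ h.isUnit, Matrix.one_mulVec]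

theorem resolventVec_self {n : ℕ} {k : Fin n} {A : Matrix (Fin n) (Fin n) ℂ}
    (h : (compressionDefect k A).det ≠ 0) : resolventVec k A k = 1 := by
  have := congrFun (compressionDefect_mulVec_resolventVec h) k
  simpa [compressionDefect_mulVec] using this

theorem mulVec_resolventVec {n : ℕ} {k : Fin n} {A : Matrix (Fin n) (Fin n) ℂ}
    (h : (compressionDefect k A).det ≠ 0) {i : Fin n} (hi : i ≠ k) :
    A.mulVec (resolventVec k A) i = resolventVec k A i := by
  have := congrFun (compressionDefect_mulVec_resolventVec h) i
  rw [compressionDefect_mulVec, if_neg hi, Pi.single_eq_of_ne hi] at this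
  exact (sub_eq_zero.1 this).symm

theorem mulVec_resolventVec_self {n : ℕ} (k : Fin n) (A : Matrix (Fin n) (Fin n) ℂ) :
    A.mulVec (resolventVec k A) k = transfer k A := by
  rw [resolventVec, Matrix.mulVec_mulVec, transfer, Matrix.mulVec_single_one]
  rfl

/-- Norm identity for the transfer function of `ζ g`, `g` unitary. -/
theorem norm_transfer_sq {n : ℕ} {k : Fin n} {g : Matrix (Fin n) (Fin n) ℂ}
    (hg : g ∈ Matrix.unitaryGroup (Fin n) ℂ) {ζ : ℂ}
    (h : (compressionDefect k (ζ • g)).det ≠ 0) :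
    ‖transfer k (ζ • g)‖ ^ 2 + ∑ i ∈ Finset.univ.erase k, ‖resolventVec k (ζ • g) i‖ ^ 2 =
      ‖ζ‖ ^ 2 * (1 + ∑ i ∈ Finset.univ.erase k, ‖resolventVec k (ζ • g) i‖ ^ 2) := by
  -- With `A = ζ g` and `v` the resolvent vector, `v_k = 1`, while `A v` agrees with `v` off `k` and
  -- has `k`-th entry the transfer function. Comparing `‖A v‖²` with `|ζ|² ‖v‖²` gives the identity.
  have h1 : ∑ i, ‖(ζ • g).mulVec (resolventVec k (ζ • g)) i‖ ^ 2 =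
      ‖ζ‖ ^ 2 * ∑ i, ‖resolventVec k (ζ • g) i‖ ^ 2 := by
    rw [← sum_norm_sq_mulVec hg (resolventVec k (ζ • g)), Finset.mul_sum]
    simp [Matrix.smul_mulVec, mul_pow]
  rw [← Finset.add_sum_erase _ _ (Finset.mem_univ k), mulVec_resolventVec_self,
    ← Finset.add_sum_erase _ (fun i => ‖resolventVec k (ζ • g) i‖ ^ 2) (Finset.mem_univ k),
    resolventVec_self h] at h1
  rw [Finset.sum_congr rfl fun i hi => by
    rw [mulVec_resolventVec h (Finset.ne_of_mem_erase hi)]] at h1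
  simpa using h1

theorem norm_transfer_eq_one {n : ℕ} {k : Fin n} {g : Matrix (Fin n) (Fin n) ℂ}
    (hg : g ∈ Matrix.unitaryGroup (Fin n) ℂ) {ζ : ℂ} (hζ : ‖ζ‖ = 1)
    (h : (compressionDefect k (ζ • g)).det ≠ 0) : ‖transfer k (ζ • g)‖ = 1 := by
  have := norm_transfer_sq hg h
  rw [hζ] at this
  have h2 : ‖transfer k (ζ • g)‖ ^ 2 = 1 := by linarith
  exact (pow_eq_one_iff_of_nonneg (norm_nonneg _) two_ne_zero).1 h2

theorem norm_transfer_le_one {n : ℕ} {k : Fin n} {g : Matrix (Fin n) (Fin n) ℂ}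
    (hg : g ∈ Matrix.unitaryGroup (Fin n) ℂ) {ζ : ℂ} (hζ : ‖ζ‖ ≤ 1)
    (h : (compressionDefect k (ζ • g)).det ≠ 0) : ‖transfer k (ζ • g)‖ ≤ 1 := by
  have := norm_transfer_sq hg h
  have hs : 0 ≤ ∑ i ∈ Finset.univ.erase k, ‖resolventVec k (ζ • g) i‖ ^ 2 := by positivity
  have hz : ‖ζ‖ ^ 2 ≤ 1 := pow_le_one₀ (norm_nonneg _) hζ
  have h2 : ‖transfer k (ζ • g)‖ ^ 2 ≤ 1 := by nlinarith
  exact (sq_le_one_iff₀ (norm_nonneg _)).1 h2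

/-- A kernel vector `v` vanishes at `k` and equals `ζ g v` elsewhere, so `‖v‖² ≤ |ζ|² ‖v‖²`. Thus
the transfer function has no pole inside the disc. -/
theorem det_compressionDefect_ne_zero_of_norm_lt {n : ℕ} (k : Fin n)
    {g : Matrix (Fin n) (Fin n) ℂ} (hg : g ∈ Matrix.unitaryGroup (Fin n) ℂ) {ζ : ℂ}
    (hζ : ‖ζ‖ < 1) : (compressionDefect k (ζ • g)).det ≠ 0 := by
  intro h0
  obtain ⟨v, hv, hv0⟩ := Matrix.exists_mulVec_eq_zero_iff.2 h0
  have h1 : ∀ i, ‖v i‖ ^ 2 ≤ ‖ζ‖ ^ 2 * ‖g.mulVec v i‖ ^ 2 := by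
    intro i
    have := congrFun hv0 i
    rw [compressionDefect_mulVec, Pi.zero_apply] at this
    split_ifs at this with hi
    · rw [hi, this]
      rw [norm_zero, zero_pow two_ne_zero]
      positivity
    · rw [sub_eq_zero.1 this, Matrix.smul_mulVec, Pi.smul_apply, norm_smul, mul_pow]
  have h2 : ∑ i, ‖v i‖ ^ 2 ≤ ‖ζ‖ ^ 2 * ∑ i, ‖v i‖ ^ 2 := by
    conv_rhs => rw [← sum_norm_sq_mulVec hg, Finset.mul_sum]
    exact Finset.sum_le_sum fun i _ => h1 i
  have h3 : 0 < ∑ i, ‖v i‖ ^ 2 := by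
    obtain ⟨i, hi⟩ := Function.ne_iff.1 hv
    exact Finset.sum_pos' (fun _ _ => by positivity) ⟨i, Finset.mem_univ _, by
      have : 0 < ‖v i‖ := norm_pos_iff.2 hi
      positivity⟩
  have h4 : ‖ζ‖ ^ 2 < 1 := pow_lt_one₀ (norm_nonneg _) hζ two_ne_zero
  nlinarith

/-- As a function of `ζ` the determinant is a reversed characteristic polynomial, nonzero because
its value at `0` is `1`. -/
theorem finite_det_compressionDefect_eq_zero {n : ℕ} (k : Fin n)
    (g : Matrix (Fin n) (Fin n) ℂ) :
    {ζ : ℂ | (compressionDefect k (ζ • g)).det = 0}.Finite := by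
  set M := g.updateRow k 0 with hM
  have hp : M.charpolyRev ≠ 0 := by
    intro h
    have := Matrix.eval_charpolyRev (M := M)
    rw [h] at this
    simp at this
  refine (Polynomial.finite_setOfPred_isRoot hp).subset ?_
  intro ζ hζ
  simp only [Set.mem_ofPred_eq, Polynomial.IsRoot.def]
  rw [Set.mem_ofPred_eq] at hζ
  rw [Matrix.charpolyRev, ← Polynomial.coe_evalRingHom, RingHom.map_det, ← hζ]
  congr 1
  ext i j
  have h1 : Polynomial.eval ζ ((1 : Matrix (Fin n) (Fin n) (Polynomial ℂ)) i j) =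
      (1 : Matrix (Fin n) (Fin n) ℂ) i j := by
    rw [Matrix.one_apply, Matrix.one_apply]
    split_ifs <;> simp
  by_cases hi : i = k
  · simp [compressionDefect, hM, Matrix.updateRow_apply, hi ▸ h1, hi]
  · simp [compressionDefect, hM, Matrix.updateRow_apply, h1, hi]
    ring

theorem differentiable_det {n : ℕ} {M : ℂ → Matrix (Fin n) (Fin n) ℂ}
    (hM : ∀ i j, Differentiable ℂ fun z => M z i j) : Differentiable ℂ fun z => (M z).det := by
  simp_rw [Matrix.det_apply]
  fun_prop

/-- Cramer's rule: a rational expression in the entries, from which both holomorphy and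
measurability are read off. -/
theorem transfer_eq {n : ℕ} (k : Fin n) (A : Matrix (Fin n) (Fin n) ℂ) :
    transfer k A = (compressionDefect k A).det⁻¹ *
      ∑ j, A k j * ((compressionDefect k A).updateRow k (Pi.single j 1)).det := by
  rw [transfer, Matrix.inv_def, Ring.inverse_eq_inv', Matrix.mul_smul, Matrix.smul_apply,
    smul_eq_mul, Matrix.mul_apply]
  simp_rw [Matrix.adjugate_apply]

theorem compressionDefect_apply {n : ℕ} (k : Fin n) (A : Matrix (Fin n) (Fin n) ℂ) (i j : Fin n) :
    compressionDefect k A i j = (1 : Matrix (Fin n) (Fin n) ℂ) i j - if i = k then 0 else A i j := by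
  simp [compressionDefect, Matrix.updateRow_apply]

theorem differentiableAt_transfer {n : ℕ} {k : Fin n} {g : Matrix (Fin n) (Fin n) ℂ} {ζ : ℂ}
    (h : (compressionDefect k (ζ • g)).det ≠ 0) :
    DifferentiableAt ℂ (fun z => transfer k (z • g)) ζ := by
  have hd : ∀ i j, Differentiable ℂ fun z : ℂ => compressionDefect k (z • g) i j := by
    intro i j
    simp_rw [compressionDefect_apply]
    split_ifs <;> simp
  simp_rw [transfer_eq]
  refine DifferentiableAt.mul ?_ ?_
  · exact (differentiable_det hd ζ).inv h
  · refine DifferentiableAt.fun_sum fun j _ => DifferentiableAt.mul ?_ ?_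
    · simp
    · refine (differentiable_det fun i l => ?_) ζ
      simp_rw [Matrix.updateRow_apply]
      split_ifs
      · fun_prop
      · exact hd i l

/-- If `g D` fixes a nonzero vector, where `D` multiplies the `k`-th coordinate by `z`, then
the transfer function of `g` is `z⁻¹`. -/
theorem transfer_eq_of_fixed {n : ℕ} {k : Fin n} {g D : Matrix (Fin n) (Fin n) ℂ} {z : ℂ}
    (h : (compressionDefect k g).det ≠ 0) (hz : z ≠ 0)
    (hD : D = Matrix.diagonal (Function.update 1 k z))
    {v : Fin n → ℂ} (hv : v ≠ 0) (hfix : (g * D).mulVec v = v) : transfer k g = z⁻¹ := by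
  set y := D.mulVec v with hy
  have hyi : ∀ i, i ≠ k → y i = v i := by
    intro i hi
    rw [hy, hD, Matrix.mulVec_diagonal, Function.update_of_ne hi, Pi.one_apply, one_mul]
  have hyk : y k = z * v k := by
    rw [hy, hD, Matrix.mulVec_diagonal, Function.update_self]
  have hgy : g.mulVec y = v := by rw [hy, Matrix.mulVec_mulVec, hfix]
  -- Since `D` changes only coordinate `k`, `g y = v` agrees with `y` off `k`; hence `y` is a
  -- multiple of the resolvent vector.
  have h1 : (compressionDefect k g).mulVec y = y k • Pi.single k 1 := by
    ext i
    rw [compressionDefect_mulVec, hgy]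
    split_ifs with hi
    · simp [hi]
    · simp [hi, hyi i hi]
  have h2 : y = y k • resolventVec k g := by
    rw [resolventVec, ← Matrix.mulVec_smul, ← h1, Matrix.mulVec_mulVec,
      Matrix.nonsing_inv_mul _ h.isUnit, Matrix.one_mulVec]
  have h3 : y k ≠ 0 := by
    intro h0
    rw [h0, zero_smul] at h2
    apply hv
    rw [← hgy, h2, Matrix.mulVec_zero]
  have h4 : v k = y k * transfer k g := by
    rw [← mulVec_resolventVec_self, ← hgy]
    conv_lhs => rw [h2]
    rw [Matrix.mulVec_smul]
    rfl
  have h5 : v k ≠ 0 := fun h0 => h3 (by rw [hyk, h0, mul_zero])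
  rw [hyk] at h4
  field_simp
  have : v k * (transfer k g * z) = v k * 1 := by linear_combination -h4
  exact mul_left_cancel₀ h5 this

/-! ### The uniform measure on the circle and its moments. -/

instance instMeasurableSpaceCircle : MeasurableSpace Circle := borel Circle

instance instBorelSpaceCircle : BorelSpace Circle := ⟨rfl⟩

instance : SecondCountableTopology Circle :=
  TopologicalSpace.Subtype.secondCountableTopology _

/-- The law of `e^{iθ}` for `θ` uniform on `(-π, π)`. -/
def uniformCircle : Measure Circle :=
  (ProbabilityTheory.cond volume (Set.Ioo (-Real.pi) Real.pi)).map Circle.exp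

theorem measurable_coe_circle : Measurable fun z : Circle => (z : ℂ) :=
  Continuous.measurable (by fun_prop)

theorem measurable_circleExp : Measurable Circle.exp := Circle.exp.continuous.measurable

instance : IsProbabilityMeasure (ProbabilityTheory.cond volume (Set.Ioo (-Real.pi) Real.pi)) := by
  apply cond_isProbabilityMeasure_of_finite
  · simp [Real.pi_pos]
  · simp

instance : IsProbabilityMeasure uniformCircle :=
  Measure.isProbabilityMeasure_map measurable_circleExp.aemeasurable

theorem integral_uniformCircle {f : ℂ → ℂ} (hf : Measurable f) :
    ∫ z, f z ∂uniformCircle = Real.circleAverage f 0 1 := by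
  have hfm : Measurable fun z : Circle => f z := hf.comp measurable_coe_circle
  rw [uniformCircle, integral_map measurable_circleExp.aemeasurable hfm.aestronglyMeasurable,
    Real.circleAverage_eq_integral_add (-Real.pi),
    intervalIntegral.integral_comp_add_right (fun θ => f (circleMap 0 1 θ)),
    show 0 + -Real.pi = -Real.pi by ring, show 2 * Real.pi + -Real.pi = Real.pi by ring,
    intervalIntegral.integral_of_le (by linarith [Real.pi_pos]),
    integral_Ioc_eq_integral_Ioo, ProbabilityTheory.cond, integral_smul_measure]
  have : (volume (Set.Ioo (-Real.pi) Real.pi))⁻¹.toReal = (2 * Real.pi)⁻¹ := by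
    rw [Real.volume_Ioo, ENNReal.toReal_inv, ENNReal.toReal_ofReal (by linarith [Real.pi_pos])]
    ring_nf
  rw [this]
  simp [circleMap]

theorem uniformCircle_finite {s : Set Circle} (hs : s.Finite) : uniformCircle s = 0 := by
  rw [← Set.biUnion_of_singleton s, measure_biUnion_null_iff hs.countable]
  intro z _
  rw [uniformCircle, Measure.map_apply measurable_circleExp (measurableSet_singleton z),
    cond_apply measurableSet_Ioo]
  have : Set.Ioo (-Real.pi) Real.pi ∩ Circle.exp ⁻¹' {z} ⊆ {Complex.arg z} := by
    rintro t ⟨ht, htz⟩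
    rw [Set.mem_preimage, Set.mem_singleton_iff] at htz
    rw [Set.mem_singleton_iff, ← htz, Circle.arg_exp ht.1 ht.2.le]
  rw [measure_mono_null this (by simp), mul_zero]

theorem integrable_of_continuous_circle {ν : Measure Circle} [IsFiniteMeasure ν] {f : Circle → ℂ}
    (hf : Continuous f) : Integrable f ν :=
  (BoundedContinuousFunction.mkOfCompact ⟨f, hf⟩).integrable ν

/-- A probability measure on the circle is determined by its moments of positive order. -/
theorem ext_of_circle_moments {ν₁ ν₂ : Measure Circle} [IsProbabilityMeasure ν₁]
    [IsProbabilityMeasure ν₂]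
    (h : ∀ m : ℕ, m ≠ 0 → ∫ z, (z : ℂ) ^ m ∂ν₁ = ∫ z, (z : ℂ) ^ m ∂ν₂) : ν₁ = ν₂ := by
  have hz : ∀ m : ℤ, ∫ z, ((z ^ m : Circle) : ℂ) ∂ν₁ = ∫ z, ((z ^ m : Circle) : ℂ) ∂ν₂ := by
    have hn : ∀ m : ℕ, ∫ z, ((z ^ m : Circle) : ℂ) ∂ν₁ = ∫ z, ((z ^ m : Circle) : ℂ) ∂ν₂ := by
      intro m
      by_cases hm : m = 0
      · simp [hm]
      · simpa using h m hm
    intro m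
    obtain ⟨m, rfl | rfl⟩ := m.eq_nat_or_neg
    · simpa using hn m
    -- On the circle `z⁻¹` is the conjugate of `z`, so negative moments are conjugates of positive
    -- ones.
    · have := congrArg (starRingEnd ℂ) (hn m)
      rw [← integral_conj, ← integral_conj] at this
      simpa only [zpow_neg, zpow_natCast, Circle.coe_inv_eq_conj] using this
  let e : AddCircle (2 * Real.pi) ≃ₜ Circle := AddCircle.homeomorphCircle Real.two_pi_pos.ne'
  have he : ∀ (m : ℤ) x, fourier m x = ((e x ^ m : Circle) : ℂ) := by
    intro m x
    rw [fourier_apply, AddCircle.toCircle_zsmul,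
      ← AddCircle.homeomorphCircle_apply Real.two_pi_pos.ne']
  let Φ := (ContinuousMap.compStarAlgHom' ℂ ℂ (e : C(AddCircle (2 * Real.pi), Circle))).comp
    (BoundedContinuousFunction.toContinuousMapStarₐ ℂ)
  have key : ∀ f ∈ Submodule.span ℂ (Set.range (@fourier (2 * Real.pi))),
      ∫ z, f (e.symm z) ∂ν₁ = ∫ z, f (e.symm z) ∂ν₂ := by
    intro f hf
    induction hf using Submodule.span_induction with
    | mem x hx =>
      obtain ⟨m, rfl⟩ := hx
      have : ∀ z, fourier m (e.symm z) = ((z ^ m : Circle) : ℂ) := by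
        intro z
        rw [he, e.apply_symm_apply]
      simp_rw [this]
      exact hz m
    | zero => simp
    | add f g _ _ hf hg =>
      simp only [ContinuousMap.add_apply]
      rw [integral_add, integral_add, hf, hg] <;>
      exact integrable_of_continuous_circle (by fun_prop)
    | smul c f _ hf =>
      simp only [ContinuousMap.smul_apply]
      rw [integral_smul, integral_smul, hf]
  -- Trigonometric polynomials form a star subalgebra separating points, hence determine the
  -- measure; they are pulled back from `AddCircle`.
  refine ext_of_forall_mem_subalgebra_integral_eq_of_polish (𝕜 := ℂ)
    (A := (fourierSubalgebra (T := 2 * Real.pi)).comap Φ) ?_ ?_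
  · intro x y hxy
    let c : C(Circle, ℂ) := ⟨fun z => (z : ℂ), continuous_subtype_val⟩
    refine ⟨c, ⟨c, ⟨BoundedContinuousFunction.mkOfCompact c, ?_, rfl⟩, rfl⟩, ?_⟩
    · refine Algebra.subset_adjoin ⟨1, ?_⟩
      ext x
      rw [he, zpow_one]
      rfl
    · exact fun h => hxy (Circle.ext h)
  · intro f hf
    have h1 : Φ f ∈ Submodule.span ℂ (Set.range (@fourier (2 * Real.pi))) := by
      rw [← fourierSubalgebra_coe]
      exact hf
    have := key _ h1
    simpa [Φ] using this

/-! ### Invariance of the uniform measure under the transfer function. -/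

theorem continuous_coe_U (n : ℕ) : Continuous fun g : U n => (g : Matrix (Fin n) (Fin n) ℂ) :=
  continuous_subtype_val

theorem measurable_U_apply {n : ℕ} (i j : Fin n) :
    Measurable fun g : U n => (g : Matrix (Fin n) (Fin n) ℂ) i j :=
  ((continuous_coe_U n).matrix_elem i j).measurable

theorem measurable_transfer_comp {n : ℕ} (k : Fin n) {X : Type*} [MeasurableSpace X]
    {A : X → Matrix (Fin n) (Fin n) ℂ} (hA : ∀ i j, Measurable fun x => A x i j) :
    Measurable fun x => transfer k (A x) := by
  have hdet : ∀ M : X → Matrix (Fin n) (Fin n) ℂ, (∀ i j, Measurable fun x => M x i j) →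
      Measurable fun x => (M x).det := by
    intro M hM
    simp_rw [Matrix.det_apply]
    refine Finset.measurable_sum _ fun σ _ => Measurable.const_smul ?_ _
    exact Finset.measurable_prod _ fun i _ => hM _ _
  have hC : ∀ i j, Measurable fun x => compressionDefect k (A x) i j := by
    intro i j
    simp_rw [compressionDefect_apply]
    split_ifs
    · fun_prop
    · exact measurable_const.sub (hA i j)
  simp_rw [transfer_eq]
  refine (hdet _ hC).inv.mul (Finset.measurable_sum _ fun j _ => (hA k j).mul (hdet _ ?_))
  intro i l
  simp_rw [Matrix.updateRow_apply]
  split_ifs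
  · fun_prop
  · exact hC i l

theorem circleAverage_radius (f : ℂ → ℂ) (r : ℝ) :
    Real.circleAverage f 0 r = Real.circleAverage (fun z => f (r * z)) 0 1 := by
  simp [Real.circleAverage, circleMap]

theorem transfer_zero_smul {n : ℕ} (k : Fin n) (g : Matrix (Fin n) (Fin n) ℂ) :
    transfer k ((0 : ℂ) • g) = 0 := by
  simp [transfer]

theorem ae_det_compressionDefect_ne_zero {n : ℕ} (k : Fin n) (g : Matrix (Fin n) (Fin n) ℂ) :
    ∀ᵐ z : Circle ∂uniformCircle, (compressionDefect k ((z : ℂ) • g)).det ≠ 0 := by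
  rw [ae_iff]
  simp only [not_not]
  exact uniformCircle_finite
    ((finite_det_compressionDefect_eq_zero k g).preimage Circle.coe_injective.injOn)

theorem integral_pow_uniformCircle {m : ℕ} (hm : m ≠ 0) :
    ∫ z : Circle, (z : ℂ) ^ m ∂uniformCircle = 0 := by
  rw [integral_uniformCircle (f := fun z => z ^ m) (by fun_prop), DiffContOnCl.circleAverage]
  · simp [hm]
  · exact (differentiable_pow m).diffContOnCl

theorem map_inv_uniformCircle : uniformCircle.map (fun z => z⁻¹) = uniformCircle := by
  have := Measure.isProbabilityMeasure_map (μ := uniformCircle)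
    (measurable_inv (G := Circle)).aemeasurable
  refine ext_of_circle_moments fun m hm => ?_
  rw [integral_map measurable_inv.aemeasurable
    (measurable_coe_circle.pow_const m).aestronglyMeasurable, integral_pow_uniformCircle hm]
  have := congrArg (starRingEnd ℂ) (integral_pow_uniformCircle hm)
  rw [← integral_conj, map_zero] at this
  simpa only [map_pow, Circle.coe_inv_eq_conj] using this

/-- The transfer function of a unitary matrix is inner and vanishes at the origin, so its
positive moments on the circle vanish. -/
theorem integral_transfer_pow {n : ℕ} (k : Fin n) {g : Matrix (Fin n) (Fin n) ℂ}
    (hg : g ∈ Matrix.unitaryGroup (Fin n) ℂ) {m : ℕ} (hm : m ≠ 0) :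
    ∫ z : Circle, transfer k ((z : ℂ) • g) ^ m ∂uniformCircle = 0 := by
  have hmeas : Measurable fun z : ℂ => transfer k (z • g) ^ m :=
    (measurable_transfer_comp k fun i j => by simp; fun_prop).pow_const m
  -- Any radii in `[0, 1)` tending to `1` would do. The boundary is approached from inside because
  -- finitely many zeros of the determinant may lie on the unit circle.
  set r : ℕ → ℝ := fun N => 1 - 1 / ((N : ℝ) + 2) with hr
  have hr0 : ∀ N, 0 ≤ r N := by
    intro N
    have : 1 / ((N : ℝ) + 2) ≤ 1 := by
      rw [div_le_one (by positivity)]; linarith [(Nat.cast_nonneg N : (0 : ℝ) ≤ N)]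
    simp only [hr]; linarith
  have hr1 : ∀ N, r N < 1 := by
    intro N
    have : 0 < 1 / ((N : ℝ) + 2) := by positivity
    simp only [hr]; linarith
  have hrt : Tendsto r atTop (𝓝 1) := by
    have h := (tendsto_const_nhds (x := (2 : ℝ))).add_atTop
      (tendsto_natCast_atTop_atTop (R := ℝ)) |>.inv_tendsto_atTop
    have := (tendsto_const_nhds (x := (1 : ℝ))).sub h
    rw [sub_zero] at this
    refine this.congr fun N => ?_
    simp [hr, add_comm]
  have hball : ∀ N (z : Circle), ‖(r N : ℂ) * z‖ < 1 := by
    intro N z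
    rw [norm_mul, Circle.norm_coe, mul_one, Complex.norm_real, Real.norm_of_nonneg (hr0 N)]
    exact hr1 N
  have hzero : ∀ N, ∫ z : Circle, transfer k (((r N : ℂ) * z) • g) ^ m ∂uniformCircle = 0 := by
    intro N
    rw [integral_uniformCircle (f := fun z => transfer k (((r N : ℂ) * z) • g) ^ m)
      (hmeas.comp (by fun_prop)), ← circleAverage_radius (fun z => transfer k (z • g) ^ m)]
    -- Mean value property: the average is the value at the centre, `0 ^ m = 0`.
    rw [DiffContOnCl.circleAverage]
    · rw [transfer_zero_smul, zero_pow hm]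
    · refine DifferentiableOn.diffContOnCl fun z hz => ?_
      have hz' : ‖z‖ < 1 := by
        have := Metric.closure_ball_subset_closedBall hz
        rw [Metric.mem_closedBall, dist_zero_right, abs_of_nonneg (hr0 N)] at this
        exact this.trans_lt (hr1 N)
      exact ((differentiableAt_transfer
        (det_compressionDefect_ne_zero_of_norm_lt k hg hz')).pow m).differentiableWithinAt
  have hlim : Tendsto (fun N => ∫ z : Circle, transfer k (((r N : ℂ) * z) • g) ^ m ∂uniformCircle)
      atTop (𝓝 (∫ z : Circle, transfer k ((z : ℂ) • g) ^ m ∂uniformCircle)) := by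
    refine tendsto_integral_of_dominated_convergence (fun _ => 1) ?_ (integrable_const 1) ?_ ?_
    · intro N
      exact (hmeas.comp ((measurable_const.mul measurable_coe_circle))).aestronglyMeasurable
    · refine fun N => ae_of_all _ fun z => ?_
      rw [norm_pow]
      exact pow_le_one₀ (norm_nonneg _) (norm_transfer_le_one hg (hball N z).le
        (det_compressionDefect_ne_zero_of_norm_lt k hg (hball N z)))
    · filter_upwards [ae_det_compressionDefect_ne_zero k g] with z hz
      have hc := ((differentiableAt_transfer hz).pow m).continuousAt
      refine hc.tendsto.comp ?_
      have : Tendsto (fun N => (r N : ℂ) * z) atTop (𝓝 (((1 : ℝ) : ℂ) * z)) :=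
        ((Complex.continuous_ofReal.tendsto 1).comp hrt).mul_const _
      simpa using this
  simp_rw [hzero] at hlim
  exact tendsto_nhds_unique hlim tendsto_const_nhds

/-- The point of the circle with the argument of the transfer function. -/
def circleTransfer {n : ℕ} (k : Fin n) (A : Matrix (Fin n) (Fin n) ℂ) : Circle :=
  Circle.exp (Complex.arg (transfer k A))

theorem coe_circleTransfer {n : ℕ} {k : Fin n} {A : Matrix (Fin n) (Fin n) ℂ}
    (h : ‖transfer k A‖ = 1) : (circleTransfer k A : ℂ) = transfer k A := by
  have := Complex.norm_mul_exp_arg_mul_I (transfer k A)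
  rw [h, Complex.ofReal_one, one_mul] at this
  rw [circleTransfer, Circle.coe_exp, this]

theorem measurable_circleTransfer_comp {n : ℕ} (k : Fin n) {X : Type*} [MeasurableSpace X]
    {A : X → Matrix (Fin n) (Fin n) ℂ} (hA : ∀ i j, Measurable fun x => A x i j) :
    Measurable fun x => circleTransfer k (A x) :=
  measurable_circleExp.comp (Complex.measurable_arg.comp (measurable_transfer_comp k hA))

/-- Löwner's lemma for the inner function `z ↦ transfer k (z g)`: all positive moments of the image
measure vanish, as do those of the uniform measure. The argument-based value agrees with `transfer`
off a finite set of `z`. -/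
theorem map_circleTransfer {n : ℕ} (k : Fin n) (g : U n) :
    uniformCircle.map (fun z : Circle => circleTransfer k ((z : ℂ) • (g : Matrix (Fin n) (Fin n) ℂ))) =
      uniformCircle := by
  have hm : Measurable fun z : Circle =>
      circleTransfer k ((z : ℂ) • (g : Matrix (Fin n) (Fin n) ℂ)) := by
    refine measurable_circleTransfer_comp k fun i j => ?_
    simp only [Matrix.smul_apply, smul_eq_mul]
    exact measurable_coe_circle.mul_const _
  have := Measure.isProbabilityMeasure_map (μ := uniformCircle) hm.aemeasurable
  refine ext_of_circle_moments fun m hm0 => ?_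
  rw [integral_map hm.aemeasurable
    (measurable_coe_circle.pow_const m).aestronglyMeasurable]
  rw [integral_pow_uniformCircle hm0, ← integral_transfer_pow k g.2 hm0]
  refine integral_congr_ae ?_
  filter_upwards [ae_det_compressionDefect_ne_zero k (g : Matrix (Fin n) (Fin n) ℂ)] with z hz
  rw [coe_circleTransfer (norm_transfer_eq_one g.2 (Circle.norm_coe z) hz)]

/-! ### Compactness of the unitary group and rotation invariance of the sphere. -/

instance (n : ℕ) : SecondCountableTopology (U n) := by
  have : SecondCountableTopology (Matrix (Fin n) (Fin n) ℂ) :=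
    inferInstanceAs (SecondCountableTopology (Fin n → Fin n → ℂ))
  exact TopologicalSpace.Subtype.secondCountableTopology _

theorem isCompact_unitaryGroup (n : ℕ) : IsCompact
    (Matrix.unitaryGroup (Fin n) ℂ : Set (Matrix (Fin n) (Fin n) ℂ)) := by
  have hc : IsCompact {M : Matrix (Fin n) (Fin n) ℂ |
      ∀ i j, M i j ∈ Metric.closedBall (0 : ℂ) 1} := by
    have h : {M : Matrix (Fin n) (Fin n) ℂ | ∀ i j, M i j ∈ Metric.closedBall (0 : ℂ) 1} =
        Set.univ.pi fun _ : Fin n => Set.univ.pi fun _ : Fin n => Metric.closedBall (0 : ℂ) 1 := by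
      ext M
      simp only [Set.mem_ofPred_eq]
      refine ⟨fun h i _ j _ => h i j, fun h i j => h i (Set.mem_univ _) j (Set.mem_univ _)⟩
    rw [h]
    exact isCompact_univ_pi fun _ => isCompact_univ_pi fun _ => isCompact_closedBall (0 : ℂ) 1
  refine hc.of_isClosed_subset ?_ ?_
  · have : IsClosed {M : Matrix (Fin n) (Fin n) ℂ | M * star M = 1} :=
      isClosed_eq (by fun_prop) continuous_const
    convert this using 1
    ext M
    exact Matrix.mem_unitaryGroup_iff
  · intro M hM i j
    rw [mem_closedBall_zero_iff]
    exact entry_norm_bound_of_unitary hM i j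

instance (n : ℕ) : CompactSpace (U n) := isCompact_iff_compactSpace.1 (isCompact_unitaryGroup n)

section Sphere

open scoped Pointwise

variable {E : Type*} [NormedAddCommGroup E] [InnerProductSpace ℝ E] [FiniteDimensional ℝ E]
  [MeasurableSpace E] [BorelSpace E]

/-- Surface measure of `s` is a constant times the volume of the cone `(0,1)·s`; `L` commutes with
forming cones and preserves volume. -/
theorem map_toSphere_linearIsometryEquiv (L : E ≃ₗᵢ[ℝ] E)
    (φ : Metric.sphere (0 : E) 1 → Metric.sphere (0 : E) 1) (hφ : ∀ x, (φ x : E) = L x) :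
    (volume : Measure E).toSphere.map φ = (volume : Measure E).toSphere := by
  have hφm : Measurable φ := by
    refine Continuous.measurable ?_
    rw [continuous_induced_rng]
    exact (L.continuous.comp continuous_subtype_val).congr fun x => (hφ x).symm
  ext s hs
  rw [Measure.map_apply hφm hs, Measure.toSphere_apply' _ (hφm hs), Measure.toSphere_apply' _ hs]
  congr 1
  have h1 : Set.Ioo (0 : ℝ) 1 • (Subtype.val '' (φ ⁻¹' s)) =
      L ⁻¹' (Set.Ioo (0 : ℝ) 1 • (Subtype.val '' s)) := by
    ext y
    simp only [Set.mem_smul, Set.mem_image, Set.mem_preimage, Subtype.exists]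
    constructor
    · rintro ⟨t, ht, _, ⟨x, hx, hxs, rfl⟩, rfl⟩
      refine ⟨t, ht, L x, ⟨(φ ⟨x, hx⟩ : E), (φ ⟨x, hx⟩).2, hxs, hφ _⟩, ?_⟩
      rw [map_smul]
    · rintro ⟨t, ht, _, ⟨x, hx, hxs, rfl⟩, hy⟩
      have hx' : L.symm x ∈ Metric.sphere (0 : E) 1 := by
        rw [mem_sphere_zero_iff_norm] at hx ⊢
        rw [L.symm.norm_map, hx]
      refine ⟨t, ht, L.symm x, ⟨L.symm x, hx', ?_, rfl⟩, ?_⟩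
      · have : φ ⟨L.symm x, hx'⟩ = ⟨x, hx⟩ := Subtype.ext (by rw [hφ]; simp)
        rw [this]
        exact hxs
      · apply L.injective
        rw [map_smul, ← hy, L.apply_symm_apply]
  rw [h1]
  exact L.measurePreserving.measure_preimage_equiv (f := L.toMeasurableEquiv) _

end Sphere

instance isProbabilityMeasure_uniformTailSphere {n : ℕ} (k : Fin n) :
    IsProbabilityMeasure (uniformTailSphere k) := by
  have : Nonempty {j : Fin n // k ≤ j} := ⟨⟨k, le_rfl⟩⟩
  constructor
  rw [uniformTailSphere, Measure.smul_apply, smul_eq_mul, ENNReal.inv_mul_cancel]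
  · rw [Ne, Measure.measure_univ_eq_zero]
    exact Measure.toSphere_ne_zero _
  · exact measure_ne_top _ _

instance isProbabilityMeasure_nu {n : ℕ} (k : Fin n) : IsProbabilityMeasure (nu k) :=
  Measure.isProbabilityMeasure_map (measurable_reflection k).aemeasurable

/-! ### Stabilizers and the subgroup algorithm. -/

/-- The subgroup of `U(n)` fixing the first `k` basis vectors. -/
def fixing (n k : ℕ) : Subgroup (U n) where
  carrier := {g | ∀ j : Fin n, (j : ℕ) < k →
    (g : Matrix (Fin n) (Fin n) ℂ).mulVec (Pi.single j 1) = Pi.single j 1}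
  mul_mem' := by
    intro a b ha hb j hj
    rw [Submonoid.coe_mul, ← Matrix.mulVec_mulVec, hb j hj, ha j hj]
  one_mem' := by
    intro j _
    rw [Submonoid.coe_one, Matrix.one_mulVec]
  inv_mem' := by
    intro a ha j hj
    conv_lhs => rw [← ha j hj]
    rw [Matrix.mulVec_mulVec, ← Submonoid.coe_mul, inv_mul_cancel, Submonoid.coe_one,
      Matrix.one_mulVec]

theorem fixing_zero (n : ℕ) : fixing n 0 = ⊤ := by
  rw [eq_top_iff]
  intro g _ j hj
  omega

theorem fixing_self (n : ℕ) : fixing n n = ⊥ := by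
  rw [eq_bot_iff]
  intro g hg
  rw [Subgroup.mem_bot]
  ext i j
  have := congrFun (hg j j.2) i
  simpa [Matrix.mulVec_single_one, Pi.single_apply, Matrix.one_apply] using this

/-- The inverse also fixes `e_i` and is the conjugate transpose, so the `i`-th row, like the column,
is `e_i`. Hence such a `g` preserves the vectors supported on `j ≥ k`. -/
theorem row_of_mem_fixing {n k : ℕ} {g : U n} (hg : g ∈ fixing n k) {i : Fin n} (hi : (i : ℕ) < k)
    (v : Fin n → ℂ) : (g : Matrix (Fin n) (Fin n) ℂ).mulVec v i = v i := by
  have h1 := inv_mem hg i hi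
  have h2 : ∀ j, (g : Matrix (Fin n) (Fin n) ℂ) i j = (Pi.single i (1 : ℂ) : Fin n → ℂ) j := by
    intro j
    have := congrArg star (congrFun h1 j)
    rw [Matrix.mulVec_single_one] at this
    have h3 : ((g⁻¹ : U n) : Matrix (Fin n) (Fin n) ℂ) = star (g : Matrix (Fin n) (Fin n) ℂ) := rfl
    rw [h3] at this
    simp only [Matrix.col_apply, Matrix.star_apply, star_star] at this
    rw [this]
    by_cases hij : j = i
    · simp [hij]
    · simp [hij]
  simp only [Matrix.mulVec, dotProduct, h2]
  simp [Pi.single_apply]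

/-- Extension by zero of a vector with coordinates `j ≥ k`. -/
def extendVec {n : ℕ} (k : Fin n) (x : EuclideanSpace ℂ {j : Fin n // k ≤ j}) : Fin n → ℂ :=
  fun j => if h : k ≤ j then x ⟨j, h⟩ else 0

theorem extendVec_coe {n : ℕ} {k : Fin n} (x : EuclideanSpace ℂ {j : Fin n // k ≤ j})
    (j : {j : Fin n // k ≤ j}) : extendVec k x j = x j := by
  simp [extendVec, j.2]

theorem extendZero_eq_extendVec {n : ℕ} (k : Fin n) (x : TailSphere k) :
    extendZero k x = extendVec k x.1 := rfl

theorem sum_extendVec {n : ℕ} {k : Fin n} (x : EuclideanSpace ℂ {j : Fin n // k ≤ j})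
    {M : Type*} [AddCommMonoid M] (f : Fin n → ℂ → M) (hf : ∀ j, f j 0 = 0) :
    ∑ j, f j (extendVec k x j) = ∑ j : {j : Fin n // k ≤ j}, f j (x j) := by
  rw [← Finset.sum_subset (Finset.subset_univ (Finset.univ.filter fun j => k ≤ j))]
  · rw [Finset.sum_subtype (p := fun j => k ≤ j) _ (by simp)]
    exact Finset.sum_congr rfl fun j _ => by rw [extendVec_coe]
  · intro j _ hj
    have : ¬ k ≤ j := by simpa using hj
    simp [extendVec, this, hf]

/-- The action of an element of `fixing n k` on the vectors with coordinates `j ≥ k`. -/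
def tailMap {n : ℕ} (k : Fin n) (g : U n) :
    EuclideanSpace ℂ {j : Fin n // k ≤ j} →ₗ[ℂ] EuclideanSpace ℂ {j : Fin n // k ≤ j} :=
  Matrix.toEuclideanLin ((g : Matrix (Fin n) (Fin n) ℂ).submatrix Subtype.val Subtype.val)

theorem extendVec_tailMap {n : ℕ} {k : Fin n} {g : U n} (hg : g ∈ fixing n k)
    (x : EuclideanSpace ℂ {j : Fin n // k ≤ j}) :
    extendVec k (tailMap k g x) = (g : Matrix (Fin n) (Fin n) ℂ).mulVec (extendVec k x) := by
  ext i
  by_cases hi : k ≤ i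
  · have h1 : extendVec k (tailMap k g x) i = tailMap k g x ⟨i, hi⟩ := by simp [extendVec, hi]
    rw [h1]
    have := sum_extendVec x (fun j z => (g : Matrix (Fin n) (Fin n) ℂ) i j * z) (by simp)
    rw [Matrix.mulVec, dotProduct, this]
    simp [tailMap, Matrix.toLpLin_apply, Matrix.mulVec, dotProduct]
  · rw [row_of_mem_fixing hg (by simpa using hi)]
    simp [extendVec, hi]

theorem norm_tailMap {n : ℕ} {k : Fin n} {g : U n} (hg : g ∈ fixing n k)
    (x : EuclideanSpace ℂ {j : Fin n // k ≤ j}) : ‖tailMap k g x‖ = ‖x‖ := by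
  rw [← sq_eq_sq₀ (norm_nonneg _) (norm_nonneg _), EuclideanSpace.norm_sq_eq,
    EuclideanSpace.norm_sq_eq, ← sum_extendVec _ (fun _ z => ‖z‖ ^ 2) (by simp),
    ← sum_extendVec _ (fun _ z => ‖z‖ ^ 2) (by simp), extendVec_tailMap hg,
    sum_norm_sq_mulVec g.2]

theorem exists_sphere_map {n : ℕ} (k : Fin n) {g : U n} (hg : g ∈ fixing n k) :
    ∃ φ : TailSphere k → TailSphere k, Measurable φ ∧
      (uniformTailSphere k).map φ = uniformTailSphere k ∧
      ∀ x, extendZero k (φ x) = (g : Matrix (Fin n) (Fin n) ℂ).mulVec (extendZero k x) := by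
  let L₀ : EuclideanSpace ℂ {j : Fin n // k ≤ j} →ₗᵢ[ℝ] EuclideanSpace ℂ {j : Fin n // k ≤ j} :=
    ⟨(tailMap k g).restrictScalars ℝ, norm_tailMap hg⟩
  let L := L₀.toLinearIsometryEquiv rfl
  have hL : ∀ x, L x = tailMap k g x := fun _ => rfl
  let φ : TailSphere k → TailSphere k := fun x => ⟨L x, by
    rw [mem_sphere_zero_iff_norm, L.norm_map]
    exact mem_sphere_zero_iff_norm.1 x.2⟩
  refine ⟨φ, ?_, ?_, ?_⟩
  · exact ((L.continuous.comp continuous_subtype_val).subtype_mk _).measurable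
  · rw [uniformTailSphere, Measure.map_smul]
    congr 1
    exact map_toSphere_linearIsometryEquiv L φ fun _ => rfl
  · intro x
    exact extendVec_tailMap hg x.1

theorem reflection_mulVec_self {n : ℕ} (k : Fin n) (x : TailSphere k) :
    (reflection k x : Matrix (Fin n) (Fin n) ℂ).mulVec (Pi.single k 1) = extendZero k x := by
  ext i
  simp [reflection, reflectionMatrix]

theorem reflection_mem_fixing {n : ℕ} (k : Fin n) (x : TailSphere k) :
    reflection k x ∈ fixing n k := by
  intro j hj
  have h1 : ¬ k ≤ j := by simpa using hj
  have h2 : j ≠ k := by rintro rfl; exact h1 le_rfl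
  ext i
  simp [reflection, reflectionMatrix, h2, extendZero, h1, Pi.single_apply]

/-- Invariance of a measure under left translation by the elements of a subgroup. -/
def LeftInvariantUnder {G : Type*} [Group G] [MeasurableSpace G] (H : Subgroup G)
    (ρ : Measure G) : Prop :=
  ∀ h ∈ H, ρ.map (fun x => h * x) = ρ

theorem LeftInvariantUnder.lintegral {G : Type*} [Group G] [MeasurableSpace G] [MeasurableMul G]
    {H : Subgroup G} {ρ : Measure G} (hρ : LeftInvariantUnder H ρ) {h : G} (hh : h ∈ H)
    {f : G → ENNReal} (hf : Measurable f) : ∫⁻ x, f (h * x) ∂ρ = ∫⁻ x, f x ∂ρ := by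
  conv_rhs => rw [← hρ h hh, lintegral_map hf (measurable_const_mul h)]

/-- Let `g` move the sphere by `φ`. Then `g r(x)` and `r(φ x)` agree on `e_j` for `j ≤ k`, so `g
r(x) = r(φ x) h(x)` with `h(x)` in the next stabilizer. The measure `ρ` absorbs `h(x)` for each `x`,
and the uniform law on the sphere absorbs `φ`. -/
theorem leftInvariantUnder_nu_mconv {n : ℕ} (k : Fin n) {ρ : Measure (U n)} [SFinite ρ]
    (hρ : LeftInvariantUnder (fixing n (k + 1)) ρ) :
    LeftInvariantUnder (fixing n k) (nu k ∗ₘ ρ) := by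
  intro g hg
  obtain ⟨φ, hφm, hφ, hφe⟩ := exists_sphere_map k hg
  have hmem : ∀ x, (reflection k (φ x))⁻¹ * (g * reflection k x) ∈ fixing n (k + 1) := by
    intro x j hj
    rcases Nat.lt_succ_iff_lt_or_eq.1 hj with hj | hj
    · exact mul_mem (inv_mem (reflection_mem_fixing k (φ x)))
        (mul_mem hg (reflection_mem_fixing k x)) j hj
    · obtain rfl : j = k := Fin.ext hj
      rw [Submonoid.coe_mul, Submonoid.coe_mul, ← Matrix.mulVec_mulVec, ← Matrix.mulVec_mulVec,
        reflection_mulVec_self, ← hφe, ← reflection_mulVec_self, Matrix.mulVec_mulVec,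
        ← Submonoid.coe_mul, inv_mul_cancel, Submonoid.coe_one, Matrix.one_mulVec]
  refine Measure.ext_of_lintegral _ fun f hf => ?_
  have hF : Measurable fun x => ∫⁻ h, f (reflection k x * h) ∂ρ := by
    refine Measurable.lintegral_prod_right' (f := fun p : TailSphere k × U n =>
      f (reflection k p.1 * p.2)) ?_
    exact hf.comp (((measurable_reflection k).comp measurable_fst).mul measurable_snd)
  have hF' : ∀ f : U n → ENNReal, Measurable f →
      Measurable fun x : U n => ∫⁻ h, f (x * h) ∂ρ := fun f hf =>
    Measurable.lintegral_prod_right' (f := fun p : U n × U n => f (p.1 * p.2))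
      (hf.comp measurable_mul)
  have hfg : Measurable fun x => f (g * x) := hf.comp (measurable_const_mul g)
  rw [lintegral_map hf (measurable_const_mul g), Measure.lintegral_mconv hfg,
    Measure.lintegral_mconv hf, nu, lintegral_map (hF' _ hfg) (measurable_reflection k),
    lintegral_map (hF' _ hf) (measurable_reflection k)]
  calc ∫⁻ x, ∫⁻ h, f (g * (reflection k x * h)) ∂ρ ∂(uniformTailSphere k)
      = ∫⁻ x, ∫⁻ h, f (reflection k (φ x) *
          (((reflection k (φ x))⁻¹ * (g * reflection k x)) * h)) ∂ρ ∂(uniformTailSphere k) := by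
        congr! 5
        group
    _ = ∫⁻ x, ∫⁻ h, f (reflection k (φ x) * h) ∂ρ ∂(uniformTailSphere k) := by
        congr! 2 with x
        exact hρ.lintegral (hmem x) (hf.comp (measurable_const_mul _))
    _ = ∫⁻ x, ∫⁻ h, f (reflection k x * h) ∂ρ ∂(uniformTailSphere k) := by
        conv_rhs => rw [← hφ, lintegral_map hF hφm]

/-! ### Laws of ordered products of independent group elements. -/

section Convolution

variable {G : Type*} [Group G] [MeasurableSpace G] [MeasurableMul₂ G]

/-- The law of the ordered product of independent variables with the given laws. -/
def mconvList (l : List (Measure G)) : Measure G :=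
  l.foldr (fun ν ρ => ν ∗ₘ ρ) (Measure.dirac 1)

theorem measurable_list_ofFn_prod {Y : Type*} [MeasurableSpace Y] {m : ℕ} {F : Fin m → Y → G}
    (hF : ∀ i, Measurable (F i)) : Measurable fun y => (List.ofFn fun i => F i y).prod := by
  induction m with
  | zero => simp
  | succ m ih =>
    simp only [List.ofFn_succ, List.prod_cons]
    exact (hF 0).mul (ih fun i => hF i.succ)

theorem map_list_prod {Ω : Type*} [MeasurableSpace Ω] {P : Measure Ω} [IsProbabilityMeasure P]
    {m : ℕ} {X : Fin m → Ω → G} (hX : ∀ i, AEMeasurable (X i) P) (hind : iIndepFun X P) :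
    AEMeasurable (fun ω => (List.ofFn fun i => X i ω).prod) P ∧
      P.map (fun ω => (List.ofFn fun i => X i ω).prod) =
        mconvList (List.ofFn fun i => P.map (X i)) := by
  induction m with
  | zero =>
    simp only [List.ofFn_zero, List.prod_nil, mconvList, List.foldr_nil]
    exact ⟨aemeasurable_const, by simp⟩
  | succ m ih =>
    obtain ⟨h1, h2⟩ := ih (X := fun i => X i.succ) (fun i => hX i.succ)
      (hind.precomp (Fin.succ_injective m))
    have hprod : ∀ ω, (List.ofFn fun i => X i ω).prod =
        X 0 ω * (List.ofFn fun i : Fin m => X i.succ ω).prod := by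
      intro ω
      rw [List.ofFn_succ, List.prod_cons]
    have hi : IndepFun (X 0) (fun ω => (List.ofFn fun i : Fin m => X i.succ ω).prod) P := by
      have := hind.indepFun_finset₀ {0} (Finset.univ.map (Fin.succEmb m)) (by simp) hX
      have hl : Measurable fun y : (Finset.univ.map (Fin.succEmb m)) → G =>
          (List.ofFn fun i : Fin m => y ⟨i.succ, by simp⟩).prod := by
        exact measurable_list_ofFn_prod fun i => measurable_pi_apply _
      have h0 : Measurable fun y : ({0} : Finset (Fin (m + 1))) → G => y ⟨0, by simp⟩ :=
        measurable_pi_apply _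
      exact this.comp h0 hl
    simp_rw [hprod]
    refine ⟨(hX 0).mul h1, ?_⟩
    have := hi.map_mul_eq_map_mconv_map₀ (hX 0) h1
    rw [h2] at this
    rw [List.ofFn_succ, mconvList, List.foldr_cons]
    exact this

theorem isProbabilityMeasure_mconvList {l : List (Measure G)} (hl : ∀ ν ∈ l, IsProbabilityMeasure ν) :
    IsProbabilityMeasure (mconvList l) := by
  induction l with
  | nil => exact Measure.dirac.isProbabilityMeasure
  | cons ν l ih =>
    have := ih fun ν' h => hl ν' (List.mem_cons_of_mem _ h)
    have := hl ν List.mem_cons_self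
    exact inferInstanceAs (IsProbabilityMeasure (ν ∗ₘ mconvList l))

/-- Invariance climbs the chain of subgroups one factor at a time, starting from the point mass at
`1`, which is invariant under the trivial group. -/
theorem leftInvariantUnder_mconvList {m : ℕ} (H : Fin (m + 1) → Subgroup G)
    (hH : H (Fin.last m) = ⊥) (ν : Fin m → Measure G) [∀ i, IsProbabilityMeasure (ν i)]
    (hν : ∀ (i : Fin m) (ρ : Measure G), IsProbabilityMeasure ρ →
      LeftInvariantUnder (H i.succ) ρ → LeftInvariantUnder (H i.castSucc) (ν i ∗ₘ ρ)) :
    LeftInvariantUnder (H 0) (mconvList (List.ofFn ν)) := by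
  induction m with
  | zero =>
    intro h hh
    have : h = 1 := by
      have h0 : (0 : Fin 1) = Fin.last 0 := rfl
      rw [h0, hH] at hh
      exact Subgroup.mem_bot.1 hh
    simp [this]
  | succ m ih =>
    have := ih (fun i => H i.succ) hH (fun i => ν i.succ)
      (fun i ρ h1 h2 => hν i.succ ρ h1 h2)
    rw [List.ofFn_succ]
    refine hν 0 _ (isProbabilityMeasure_mconvList fun ν' h => ?_) this
    obtain ⟨i, rfl⟩ := List.mem_ofFn.1 h
    infer_instance

end Convolution

/-! ### The full product of reflections is Haar distributed. -/

theorem eq_of_leftInvariant {n : ℕ} (μ ρ : Measure (U n)) [μ.IsHaarMeasure]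
    [IsProbabilityMeasure μ] [IsProbabilityMeasure ρ] (hρ : LeftInvariantUnder ⊤ ρ) : ρ = μ := by
  have : ρ.IsMulLeftInvariant := ⟨fun g => hρ g (Subgroup.mem_top g)⟩
  have h := Measure.isMulInvariant_eq_smul_of_compactSpace ρ μ
  have h1 := congrArg (fun ν => ν Set.univ) h
  simp only [measure_univ, Measure.smul_apply] at h1
  have h2 : Measure.haarScalarFactor ρ μ = 1 := by
    rw [ENNReal.smul_def, smul_eq_mul, mul_one] at h1
    exact_mod_cast h1.symm
  rw [h, h2, one_smul]

theorem mconvList_nu {n : ℕ} (μ : Measure (U n)) [μ.IsHaarMeasure]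
    [IsProbabilityMeasure μ] : mconvList (List.ofFn fun k : Fin n => nu k) = μ := by
  have hp : IsProbabilityMeasure (mconvList (List.ofFn fun k : Fin n => nu k)) :=
    isProbabilityMeasure_mconvList fun ν h => by
      obtain ⟨i, rfl⟩ := List.mem_ofFn.1 h
      infer_instance
  refine eq_of_leftInvariant _ _ ?_
  have := leftInvariantUnder_mconvList (fun i : Fin (n + 1) => fixing n i)
    (by simpa using fixing_self n) (fun k => nu k) (fun i ρ _ h => leftInvariantUnder_nu_mconv i h)
  simpa [fixing_zero] using this

theorem map_mul_right_haar {n : ℕ} (μ : Measure (U n)) [μ.IsHaarMeasure]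
    [IsProbabilityMeasure μ] (g : U n) : μ.map (fun x => x * g) = μ := by
  have : IsProbabilityMeasure (μ.map (fun x => x * g)) :=
    Measure.isProbabilityMeasure_map (measurable_mul_const g).aemeasurable
  exact Measure.isHaarMeasure_eq_of_isProbabilityMeasure _ _

/-! ### Exchanging a diagonal phase for a scalar phase. -/

/-- Scalar unitary matrices. -/
def scalarU (n : ℕ) : Circle →* U n where
  toFun z := ⟨(z : ℂ) • 1, by
    rw [Matrix.mem_unitaryGroup_iff]
    simp [smul_smul, ← Complex.normSq_eq_conj_mul_self]⟩
  map_one' := by ext; simp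
  map_mul' z w := by
    ext i j
    simp [mul_assoc, mul_left_comm]

theorem coe_scalarU_mul {n : ℕ} (z : Circle) (g : U n) :
    ((scalarU n z * g : U n) : Matrix (Fin n) (Fin n) ℂ) = (z : ℂ) • (g : Matrix _ _ ℂ) := by
  simp [scalarU]

/-- The diagonal unitary matrix multiplying the `k`-th coordinate by `z`. -/
def coordU {n : ℕ} (k : Fin n) : Circle →* U n where
  toFun z := ⟨Matrix.diagonal (Function.update 1 k (z : ℂ)), by
    rw [Matrix.mem_unitaryGroup_iff, Matrix.star_eq_conjTranspose, Matrix.diagonal_conjTranspose,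
      Matrix.diagonal_mul_diagonal, ← Matrix.diagonal_one]
    congr 1
    ext i
    by_cases hi : i = k
    · subst hi; simp [Complex.mul_conj]
    · simp [hi]⟩
  map_one' := by
    ext i j
    have : Function.update (1 : Fin n → ℂ) k 1 = 1 := Function.update_eq_self k 1
    simp [this]
  map_mul' z w := by
    ext i j
    simp only [Submonoid.coe_mul, Matrix.diagonal_mul_diagonal]
    congr 2
    ext i
    by_cases hi : i = k
    · subst hi; simp
    · simp [hi]

theorem continuous_U_of_apply {n : ℕ} {X : Type*} [TopologicalSpace X] {f : X → U n}
    (hf : ∀ i j, Continuous fun x => (f x : Matrix (Fin n) (Fin n) ℂ) i j) : Continuous f :=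
  continuous_induced_rng.2 (continuous_matrix hf)

theorem continuous_scalarU (n : ℕ) : Continuous (scalarU n) :=
  continuous_U_of_apply fun i j => by simp [scalarU]; fun_prop

theorem continuous_coordU {n : ℕ} (k : Fin n) : Continuous (coordU k) := by
  refine continuous_U_of_apply fun i j => ?_
  simp only [coordU, MonoidHom.coe_mk, OneHom.coe_mk, Matrix.diagonal_apply, Function.update_apply]
  split_ifs <;> fun_prop

/-- The representative modulo `coordU k` with eigenvalue `1`. -/
def fixedRep {n : ℕ} (k : Fin n) (g : U n) : U n :=
  g * coordU k (circleTransfer k (g : Matrix (Fin n) (Fin n) ℂ))⁻¹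

theorem measurable_circleTransfer {n : ℕ} (k : Fin n) :
    Measurable fun g : U n => circleTransfer k (g : Matrix (Fin n) (Fin n) ℂ) :=
  measurable_circleTransfer_comp k measurable_U_apply

theorem measurable_fixedRep {n : ℕ} (k : Fin n) : Measurable (fixedRep k) :=
  measurable_id.mul ((continuous_coordU k).measurable.comp (measurable_circleTransfer k).inv)

/-- The transfer function of `W D(z)` is `z`, because multiplying by `D(z⁻¹)` restores the fixed
vector of `W`; so `fixedRep` strips off exactly `D(z)`. -/
theorem fixedRep_mul_coordU {n : ℕ} {k : Fin n} {W : U n} {z : Circle}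
    (hdet : (compressionDefect k ((W * coordU k z : U n) : Matrix (Fin n) (Fin n) ℂ)).det ≠ 0)
    {v : Fin n → ℂ} (hv : v ≠ 0) (hfix : (W : Matrix (Fin n) (Fin n) ℂ).mulVec v = v) :
    fixedRep k (W * coordU k z) = W := by
  have hW : W * coordU k z * coordU k z⁻¹ = W := by
    rw [mul_assoc, ← map_mul, mul_inv_cancel, map_one, mul_one]
  have h1 : transfer k ((W * coordU k z : U n) : Matrix (Fin n) (Fin n) ℂ) = z := by
    have := transfer_eq_of_fixed (z := ((z⁻¹ : Circle) : ℂ))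
      (D := (coordU k z⁻¹ : U n)) hdet (Circle.coe_ne_zero _) rfl hv
      (by rw [← Submonoid.coe_mul, hW]; exact hfix)
    rw [this, Circle.coe_inv, inv_inv]
  have h2 : circleTransfer k ((W * coordU k z : U n) : Matrix (Fin n) (Fin n) ℂ) = z := by
    apply Circle.ext
    rw [coe_circleTransfer (by rw [h1, Circle.norm_coe]), h1]
  rw [fixedRep, h2, hW]

/-- For each `g` only finitely many scalars `z` are bad. Fubini then yields one `z` for which `z g`
is good for almost every `g`, and translation invariance removes that `z`. -/
theorem ae_haar_det_compressionDefect_ne_zero {n : ℕ} (k : Fin n) (μ : Measure (U n))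
    [μ.IsHaarMeasure] [IsProbabilityMeasure μ] :
    ∀ᵐ g : U n ∂μ, (compressionDefect k (g : Matrix (Fin n) (Fin n) ℂ)).det ≠ 0 := by
  have hc : Continuous fun g : U n => (compressionDefect k (g : Matrix (Fin n) (Fin n) ℂ)).det := by
    have : Continuous fun g : U n => compressionDefect k (g : Matrix (Fin n) (Fin n) ℂ) :=
      continuous_const.sub ((continuous_coe_U n).matrix_updateRow k continuous_const)
    exact this.matrix_det
  have hm : MeasurableSet {g : U n | (compressionDefect k (g : Matrix (Fin n) (Fin n) ℂ)).det ≠ 0} :=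
    (isOpen_ne_fun hc continuous_const).measurableSet
  have hj : Measurable fun p : Circle × U n => scalarU n p.1 * p.2 :=
    ((continuous_scalarU n).measurable.comp measurable_fst).mul measurable_snd
  have h1 : ∀ᵐ g ∂μ, ∀ᵐ z ∂uniformCircle, scalarU n z * g ∈
      {g : U n | (compressionDefect k (g : Matrix (Fin n) (Fin n) ℂ)).det ≠ 0} := by
    refine ae_of_all _ fun g => ?_
    filter_upwards [ae_det_compressionDefect_ne_zero k (g : Matrix (Fin n) (Fin n) ℂ)] with z hz
    simpa only [Set.mem_ofPred_eq, coe_scalarU_mul] using hz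
  obtain ⟨z, hz⟩ := ((Measure.ae_ae_comm (p := fun z g => scalarU n z * g ∈
      {g : U n | (compressionDefect k (g : Matrix (Fin n) (Fin n) ℂ)).det ≠ 0}) (hj hm)).2 h1).exists
  rw [← map_mul_left_eq_self μ (scalarU n z)]
  exact (ae_map_iff (measurable_const_mul _).aemeasurable hm).2 hz

/-- A uniform scalar multiple of the representative with eigenvalue `1` is Haar distributed. -/
theorem lintegral_scalarU_mul_fixedRep {n : ℕ} (k : Fin n) (μ : Measure (U n))
    [μ.IsHaarMeasure] [IsProbabilityMeasure μ] {f : U n → ENNReal} (hf : Measurable f) :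
    ∫⁻ z, ∫⁻ g, f (scalarU n z * fixedRep k g) ∂μ ∂uniformCircle = ∫⁻ g, f g ∂μ := by
  have hs := (continuous_scalarU n).measurable
  have hk := (continuous_coordU k).measurable
  have hm : Measurable fun p : Circle × U n =>
      scalarU n p.1 * fixedRep k (scalarU n p.1⁻¹ * p.2) :=
    (hs.comp measurable_fst).mul ((measurable_fixedRep k).comp
      ((hs.comp measurable_fst.inv).mul measurable_snd))
  have hm2 : Measurable fun p : U n × Circle => p.1 * coordU k p.2 :=
    measurable_fst.mul (hk.comp measurable_snd)
  calc ∫⁻ z, ∫⁻ g, f (scalarU n z * fixedRep k g) ∂μ ∂uniformCircle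
      = ∫⁻ z, ∫⁻ g, f (scalarU n z * fixedRep k (scalarU n z⁻¹ * g)) ∂μ ∂uniformCircle := by
        refine lintegral_congr fun z => ?_
        exact (lintegral_mul_left_eq_self (μ := μ)
          (fun g => f (scalarU n z * fixedRep k g)) (scalarU n z⁻¹)).symm
    _ = ∫⁻ g, ∫⁻ z, f (scalarU n z * fixedRep k (scalarU n z⁻¹ * g)) ∂uniformCircle ∂μ :=
        lintegral_lintegral_swap (hf.comp hm).aemeasurable
    _ = ∫⁻ g, ∫⁻ z, f (g * coordU k z) ∂uniformCircle ∂μ := by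
        -- From here `g` is fixed and only the scalar is random; the random phase on coordinate `k`
        -- is shown to be uniform.
        refine lintegral_congr fun g => ?_
        have hT := map_circleTransfer k g
        have hTm : Measurable fun z : Circle =>
            circleTransfer k ((z : ℂ) • (g : Matrix (Fin n) (Fin n) ℂ)) := by
          simp_rw [← coe_scalarU_mul]
          exact (measurable_circleTransfer k).comp (hs.mul_const g)
        have hg : Measurable fun z : Circle => f (g * coordU k z) := hf.comp (hk.const_mul g)
        have hg' : Measurable fun z : Circle => f (g * coordU k z⁻¹) := hg.comp measurable_inv
        calc ∫⁻ z, f (scalarU n z * fixedRep k (scalarU n z⁻¹ * g)) ∂uniformCircle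
            = ∫⁻ z : Circle, f (g * coordU k
                (circleTransfer k (((z⁻¹ : Circle) : ℂ) • (g : Matrix (Fin n) (Fin n) ℂ)))⁻¹)
                ∂uniformCircle := by
              refine lintegral_congr fun z => ?_
              rw [fixedRep, coe_scalarU_mul, ← mul_assoc, ← mul_assoc, ← map_mul, mul_inv_cancel,
                map_one, one_mul]
          _ = ∫⁻ z : Circle, f (g * coordU k
                (circleTransfer k ((z : ℂ) • (g : Matrix (Fin n) (Fin n) ℂ)))⁻¹)
                ∂uniformCircle := by
              conv_rhs => rw [← map_inv_uniformCircle, lintegral_map (f := fun z : Circle =>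
                f (g * coordU k (circleTransfer k ((z : ℂ) • (g : Matrix (Fin n) (Fin n) ℂ)))⁻¹))
                (hg'.comp hTm) measurable_inv]
          _ = ∫⁻ z, f (g * coordU k z⁻¹) ∂uniformCircle := by
              conv_rhs => rw [← hT, lintegral_map hg' hTm]
          _ = ∫⁻ z, f (g * coordU k z) ∂uniformCircle := by
              conv_rhs => rw [← map_inv_uniformCircle, lintegral_map hg measurable_inv]
    _ = ∫⁻ z, ∫⁻ g, f (g * coordU k z) ∂μ ∂uniformCircle :=
        lintegral_lintegral_swap (hf.comp hm2).aemeasurable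
    _ = ∫⁻ z : Circle, ∫⁻ g, f g ∂μ ∂uniformCircle := by
        refine lintegral_congr fun z => ?_
        conv_rhs => rw [← map_mul_right_haar μ (coordU k z),
          lintegral_map hf (measurable_mul_const _)]
    _ = ∫⁻ g, f g ∂μ := by simp

/-! ### Recovering the product of all reflections but the last. -/

theorem reflection_injective {n : ℕ} (k : Fin n) : Function.Injective (reflection k) := by
  intro x y hxy
  have h : extendZero k x = extendZero k y := by
    rw [← reflection_mulVec_self, hxy, reflection_mulVec_self]
  ext j
  have := congrFun h j
  rwa [extendZero_eq_extendVec, extendZero_eq_extendVec, extendVec_coe, extendVec_coe] at this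

/-- The range is measurable because the map is measurable and injective on a standard Borel space.
-/
theorem ae_nu_mem_range {n : ℕ} (k : Fin n) : ∀ᵐ g ∂(nu k), ∃ x, reflection k x = g := by
  have hm : MeasurableSet (Set.range (reflection k)) :=
    ((measurable_reflection k).measurableEmbedding (reflection_injective k)).measurableSet_range
  exact ae_map_mem_range _ hm _

theorem rank_one_sub_reflection_le {n : ℕ} (k : Fin n) (x : TailSphere k) :
    (1 - (reflection k x : Matrix (Fin n) (Fin n) ℂ)).rank ≤ 1 := by
  set w := extendZero k x with hw
  have : 1 - (reflection k x : Matrix (Fin n) (Fin n) ℂ) =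
      Matrix.vecMulVec (fun i => w i - if i = k then 1 else 0)
        (fun j => if j = k then -1 else star (w j) / (1 - star (w k))) := by
    ext i j
    by_cases hj : j = k
    · simp [reflection, reflectionMatrix, Matrix.vecMulVec_apply, hj, Matrix.one_apply, hw]
    · simp [reflection, reflectionMatrix, Matrix.vecMulVec_apply, hj, Matrix.one_apply, hw]
  rw [this]
  exact Matrix.rank_vecMulVec_le _ _

theorem rank_add_le_rank_add_rank {n : ℕ} (A B : Matrix (Fin n) (Fin n) ℂ) :
    (A + B).rank ≤ A.rank + B.rank := by
  unfold Matrix.rank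
  rw [Matrix.mulVecLin_add]
  exact (Submodule.finrank_mono (LinearMap.range_add_le _ _)).trans
    (Submodule.finrank_add_le_finrank_add_finrank _ _)

/-- Subadditivity of rank applied to `1 - g h = (1 - g) + g (1 - h)`. -/
theorem rank_one_sub_list_prod_le {n : ℕ} {l : List (U n)}
    (hl : ∀ g ∈ l, (1 - (g : Matrix (Fin n) (Fin n) ℂ)).rank ≤ 1) :
    (1 - (l.prod : Matrix (Fin n) (Fin n) ℂ)).rank ≤ l.length := by
  induction l with
  | nil => simp
  | cons g l ih =>
    have h : 1 - ((g :: l).prod : Matrix (Fin n) (Fin n) ℂ) =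
        (1 - (g : Matrix (Fin n) (Fin n) ℂ)) +
          (g : Matrix (Fin n) (Fin n) ℂ) * (1 - (l.prod : Matrix (Fin n) (Fin n) ℂ)) := by
      rw [List.prod_cons, Submonoid.coe_mul]
      noncomm_ring
    rw [h, List.length_cons, add_comm l.length]
    refine (rank_add_le_rank_add_rank _ _).trans (add_le_add (hl g List.mem_cons_self) ?_)
    exact (Matrix.rank_mul_le_right _ _).trans (ih fun g' hg' => hl g' (List.mem_cons_of_mem _ hg'))

theorem exists_fixed_of_rank_lt {n : ℕ} {A : Matrix (Fin n) (Fin n) ℂ} (h : (1 - A).rank < n) :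
    ∃ v : Fin n → ℂ, v ≠ 0 ∧ A.mulVec v = v := by
  have hdet : (1 - A).det = 0 := by
    by_contra h0
    have := Matrix.rank_of_isUnit (1 - A) ((Matrix.isUnit_iff_isUnit_det _).2 (Ne.isUnit h0))
    rw [Fintype.card_fin] at this
    omega
  obtain ⟨v, hv, hv0⟩ := Matrix.exists_mulVec_eq_zero_iff.2 hdet
  refine ⟨v, hv, ?_⟩
  rw [Matrix.sub_mulVec, Matrix.one_mulVec, sub_eq_zero] at hv0
  exact hv0.symm

/-- The last sphere is the unit circle of `ℂ`, so the last reflection is merely a phase on the last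
coordinate. -/
theorem exists_reflection_last_eq {m : ℕ} (x : TailSphere (Fin.last m)) :
    ∃ z : Circle, reflection (Fin.last m) x = coordU (Fin.last m) z := by
  set w := extendZero (Fin.last m) x with hw
  have h0 : ∀ i, i ≠ Fin.last m → w i = 0 := by
    intro i hi
    simp [hw, extendZero, Fin.last_le_iff, hi]
  have h1 : ‖w (Fin.last m)‖ = 1 := by
    have := sum_norm_sq_mulVec (reflection (Fin.last m) x).2 (Pi.single (Fin.last m) 1)
    rw [reflection_mulVec_self, ← hw, Finset.sum_eq_single (Fin.last m)
      (fun i _ hi => by rw [h0 i hi]; simp) (by simp), Finset.sum_eq_single (Fin.last m)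
      (fun i _ hi => by simp [hi]) (by simp)] at this
    rw [Pi.single_eq_same, norm_one, one_pow] at this
    exact (pow_eq_one_iff_of_nonneg (norm_nonneg _) two_ne_zero).1 this
  have hz : (Circle.exp (Complex.arg (w (Fin.last m))) : ℂ) = w (Fin.last m) := by
    have := Complex.norm_mul_exp_arg_mul_I (w (Fin.last m))
    rw [h1, Complex.ofReal_one, one_mul] at this
    rw [Circle.coe_exp, this]
  refine ⟨Circle.exp (Complex.arg (w (Fin.last m))), ?_⟩
  ext i j
  have hc := congrFun (reflection_mulVec_self (Fin.last m) x) i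
  rw [Matrix.mulVec_single_one, Matrix.col_apply, ← hw] at hc
  simp only [coordU, MonoidHom.coe_mk, OneHom.coe_mk, hz]
  by_cases hj : j = Fin.last m
  · subst hj
    rw [hc]
    by_cases hi : i = Fin.last m
    · subst hi; simp
    · rw [h0 i hi, Matrix.diagonal_apply_ne _ hi]
  · have := congrFun (reflection_mem_fixing (Fin.last m) x j (by
      have := Fin.val_lt_last hj
      simpa using this)) i
    rw [Matrix.mulVec_single_one, Matrix.col_apply] at this
    rw [this]
    rw [Matrix.diagonal_apply, Pi.single_apply]
    split_ifs with h
    · rw [h, Function.update_of_ne hj, Pi.one_apply]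
    · rfl

theorem fixedRep_prod_reflections {m : ℕ} {g : Fin (m + 1) → U (m + 1)}
    (hg : ∀ k, ∃ x, reflection k x = g k)
    (hdet : (compressionDefect (Fin.last m)
      ((List.ofFn g).prod : Matrix (Fin (m + 1)) (Fin (m + 1)) ℂ)).det ≠ 0) :
    fixedRep (Fin.last m) (List.ofFn g).prod =
      (List.ofFn fun k : Fin m => g k.castSucc).prod := by
  obtain ⟨x, hx⟩ := hg (Fin.last m)
  obtain ⟨ζ, hζ⟩ := exists_reflection_last_eq x
  have hprod : (List.ofFn g).prod =
      (List.ofFn fun k : Fin m => g k.castSucc).prod * coordU (Fin.last m) ζ := by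
    rw [List.ofFn_succ', List.concat_eq_append, List.prod_append, List.prod_singleton, ← hζ, hx]
  have hrank := rank_one_sub_list_prod_le (l := List.ofFn fun k : Fin m => g k.castSucc) (by
    intro h hh
    obtain ⟨i, rfl⟩ := List.mem_ofFn.1 hh
    obtain ⟨y, hy⟩ := hg i.castSucc
    simp only [← hy]
    exact rank_one_sub_reflection_le _ y)
  rw [List.length_ofFn] at hrank
  obtain ⟨v, hv, hfix⟩ := exists_fixed_of_rank_lt (Nat.lt_succ_of_le hrank)
  rw [hprod] at hdet ⊢
  exact fixedRep_mul_coordU hdet hv hfix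

/-! ### Assembling the laws. -/

/-- The last reflection is auxiliary: it completes the product to a Haar matrix, from which
`fixedRep` almost surely removes it again. -/
theorem hasLaw_prod_reflections {m : ℕ} (μ : Measure (U (m + 1))) [μ.IsHaarMeasure]
    [IsProbabilityMeasure μ] {Ω : Type*} [MeasurableSpace Ω] {P : Measure Ω}
    [IsProbabilityMeasure P] {r : Fin (m + 1) → Ω → U (m + 1)}
    (hr : ∀ k, HasLaw (r k) (nu k) P) (hindep_r : iIndepFun r P) :
    HasLaw (fun ω => (List.ofFn fun k : Fin m => r k.castSucc ω).prod)
      (μ.map (fixedRep (Fin.last m))) P := by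
  obtain ⟨hXa, hX⟩ := map_list_prod (fun k => (hr k).aemeasurable) hindep_r
  have hμ : mconvList (List.ofFn fun k => P.map (r k)) = μ := by
    rw [← mconvList_nu μ]
    exact congrArg (fun l => mconvList (List.ofFn l)) (funext fun k => (hr k).map_eq)
  rw [hμ] at hX
  have h1 : ∀ᵐ ω ∂P, ∀ k, ∃ x, reflection k x = r k ω := by
    rw [ae_all_iff]
    intro k
    refine ae_of_ae_map (p := fun g => ∃ x, reflection k x = g) (hr k).aemeasurable ?_
    rw [(hr k).map_eq]
    exact ae_nu_mem_range k
  have h2 : ∀ᵐ ω ∂P, (compressionDefect (Fin.last m) ((List.ofFn fun k => r k ω).prod :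
      Matrix (Fin (m + 1)) (Fin (m + 1)) ℂ)).det ≠ 0 := by
    refine ae_of_ae_map (p := fun g : U (m + 1) => (compressionDefect (Fin.last m)
      (g : Matrix (Fin (m + 1)) (Fin (m + 1)) ℂ)).det ≠ 0) hXa ?_
    rw [hX]
    exact ae_haar_det_compressionDefect_ne_zero _ μ
  have hae : (fixedRep (Fin.last m) ∘ fun ω => (List.ofFn fun k => r k ω).prod) =ᵐ[P]
      fun ω => (List.ofFn fun k : Fin m => r k.castSucc ω).prod := by
    filter_upwards [h1, h2] with ω h1 h2
    exact fixedRep_prod_reflections h1 h2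
  have hs := measurable_fixedRep (Fin.last m)
  refine ⟨(hs.comp_aemeasurable hXa).congr hae, ?_⟩
  rw [← Measure.map_congr hae, ← AEMeasurable.map_map_of_aemeasurable hs.aemeasurable hXa, hX]

theorem measurable_scalarU_mul (m : ℕ) :
    Measurable fun p : Circle × U m => scalarU m p.1 * p.2 :=
  ((continuous_scalarU m).measurable.comp measurable_fst).mul measurable_snd

theorem map_scalarU_mul_fixedRep {m : ℕ} (k : Fin m) (μ : Measure (U m)) [μ.IsHaarMeasure]
    [IsProbabilityMeasure μ] :
    (uniformCircle.prod (μ.map (fixedRep k))).map (fun p => scalarU m p.1 * p.2) = μ := by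
  have := Measure.isProbabilityMeasure_map (μ := μ) (measurable_fixedRep k).aemeasurable
  refine Measure.ext_of_lintegral _ fun f hf => ?_
  have hfm : Measurable fun p : Circle × U m => f (scalarU m p.1 * p.2) :=
    hf.comp (measurable_scalarU_mul m)
  rw [lintegral_map hf (measurable_scalarU_mul m), lintegral_prod _ hfm.aemeasurable,
    ← lintegral_scalarU_mul_fixedRep k μ hf]
  refine lintegral_congr fun ζ => ?_
  have hfz : Measurable fun g : U m => f (scalarU m ζ * g) := hf.comp (measurable_const_mul _)
  exact lintegral_map hfz (measurable_fixedRep k)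

theorem hasLaw_scalarU_mul_fixedRep {m : ℕ} (k : Fin m) (μ : Measure (U m)) [μ.IsHaarMeasure]
    [IsProbabilityMeasure μ] {Ω : Type*} [MeasurableSpace Ω] {P : Measure Ω}
    [IsProbabilityMeasure P] {z : Ω → Circle} {W : Ω → U m}
    (hz : HasLaw z uniformCircle P) (hW : HasLaw W (μ.map (fixedRep k)) P)
    (hind : IndepFun z W P) : HasLaw (fun ω => scalarU m (z ω) * W ω) μ P := by
  have hpair := (indepFun_iff_map_prod_eq_prod_map_map hz.aemeasurable hW.aemeasurable).1 hind
  rw [hz.map_eq, hW.map_eq] at hpair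
  have hpairlaw : HasLaw (fun ω => (z ω, W ω)) (uniformCircle.prod (μ.map (fixedRep k))) P :=
    ⟨hz.aemeasurable.prodMk hW.aemeasurable, hpair⟩
  have hmul : HasLaw (fun p : Circle × U m => scalarU m p.1 * p.2) μ
      (uniformCircle.prod (μ.map (fixedRep k))) :=
    ⟨(measurable_scalarU_mul m).aemeasurable, map_scalarU_mul_fixedRep k μ⟩
  have h := hmul.comp hpairlaw
  simp only [Function.comp_def] at h
  exact h

/-- The Haar measure of `U(m+1)` is the law of a product of `m` independent reflections
multiplied by an independent uniform scalar. -/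
theorem hasLaw_scalarU_mul_prod_reflections {m : ℕ} (μ : Measure (U (m + 1))) [μ.IsHaarMeasure]
    [IsProbabilityMeasure μ] {Ω : Type*} [MeasurableSpace Ω] {P : Measure Ω}
    [IsProbabilityMeasure P] {z : Ω → Circle} {r : Fin (m + 1) → Ω → U (m + 1)}
    (hz : HasLaw z uniformCircle P) (hr : ∀ k, HasLaw (r k) (nu k) P)
    (hindep_r : iIndepFun r P) (hindep_z : IndepFun z (fun ω k => r k ω) P) :
    HasLaw (fun ω => scalarU (m + 1) (z ω) *
      (List.ofFn fun k : Fin m => r k.castSucc ω).prod) μ P := by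
  have hWm : Measurable fun y : Fin (m + 1) → U (m + 1) =>
      (List.ofFn fun k : Fin m => y k.castSucc).prod :=
    measurable_list_ofFn_prod fun i => measurable_pi_apply _
  exact hasLaw_scalarU_mul_fixedRep (Fin.last m) μ hz (hasLaw_prod_reflections μ hr hindep_r)
    (hindep_z.comp measurable_id hWm)

end ConditionalHaar

end

theorem lemma3p1 {n : ℕ} (hn : 1 ≤ n)
    -- the Haar probability measure of `U(n)`
    (μ : Measure (ConditionalHaar.U n)) [μ.IsHaarMeasure] [IsProbabilityMeasure μ]
    {Ω : Type*} [MeasurableSpace Ω] (P : Measure Ω) [IsProbabilityMeasure P]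
    (u : Ω → ConditionalHaar.U n) (θ : Ω → ℝ) (r : Fin n → Ω → ConditionalHaar.U n)
    (hu : HasLaw u μ P)
    (hθ : HasLaw θ (ProbabilityTheory.cond volume (Set.Ioo (-Real.pi) Real.pi)) P)
    (hr : ∀ k, HasLaw (r k) (ConditionalHaar.nu k) P)
    -- `u`, `θ` and all the `r k` are mutually independent
    (hindep_r : iIndepFun r P)
    (hindep_θ : IndepFun θ (fun ω k => r k ω) P)
    (hindep_u : IndepFun u (fun ω => (θ ω, fun k => r k ω)) P) :
    -- equality in law of the spectra; the product is taken in increasing order of `k`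
    IdentDistrib
      (fun ω => ConditionalHaar.spec (u ω : Matrix (Fin n) (Fin n) ℂ))
      (fun ω => ConditionalHaar.spec
        (Complex.exp (Complex.I * (θ ω : ℂ)) •
          (((List.ofFn fun k : Fin (n - 1) => r (Fin.castLE (Nat.sub_le n 1) k) ω).prod :
            ConditionalHaar.U n) : Matrix (Fin n) (Fin n) ℂ)))
      P P := by

  obtain ⟨m, rfl⟩ : ∃ m, n = m + 1 := ⟨n - 1, by omega⟩
  have hz : HasLaw (fun ω => Circle.exp (θ ω)) ConditionalHaar.uniformCircle P := by
    refine ⟨ConditionalHaar.measurable_circleExp.comp_aemeasurable hθ.aemeasurable, ?_⟩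
    rw [ConditionalHaar.uniformCircle, ← hθ.map_eq, AEMeasurable.map_map_of_aemeasurable
      ConditionalHaar.measurable_circleExp.aemeasurable hθ.aemeasurable]
    rfl
  have h := ConditionalHaar.hasLaw_scalarU_mul_prod_reflections μ hz hr hindep_r
    (hindep_θ.comp ConditionalHaar.measurable_circleExp measurable_id)
  have hid : IdentDistrib u _ P P :=
    ⟨hu.aemeasurable, h.aemeasurable, by rw [hu.map_eq, h.map_eq]⟩
  have hs := hid.comp (ConditionalHaar.measurable_spec (m + 1))
  have he : ∀ ω, ConditionalHaar.spec (Complex.exp (Complex.I * (θ ω : ℂ)) •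
      (((List.ofFn fun k : Fin m => r k.castSucc ω).prod : ConditionalHaar.U (m + 1)) :
        Matrix (Fin (m + 1)) (Fin (m + 1)) ℂ)) =
      ConditionalHaar.spec ((ConditionalHaar.scalarU (m + 1) (Circle.exp (θ ω)) *
        (List.ofFn fun k : Fin m => r k.castSucc ω).prod : ConditionalHaar.U (m + 1)) :
        Matrix (Fin (m + 1)) (Fin (m + 1)) ℂ) := by
    intro ω
    rw [ConditionalHaar.coe_scalarU_mul, Circle.coe_exp, mul_comm]
  have hf := funext he
  -- The two indexings of the factors, by `Fin.castLE` on `Fin (m + 1 - 1)` and by `castSucc` on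
  -- `Fin m`, agree definitionally.
  exact hf ▸ hs
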